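/- Let $(M,g)$ be a smooth (Hausdorff) manifold with a pseudo-Riemannian metric of neutral signature $(n,n)$, $\dim M=2n$, let $\nabla$ be its Levi-Civita connection, and denote also by $\nabla$ the induced connection on the bundle $\mathrm{End}(TM)$, with curvature taken with the sign convention $R(X,Y)=\nabla_{[X,Y]}-[\nabla_X,\nabla_Y]$. Let $\pi:\mathcal Z\to M$ be the reflector space of $(M,g)$: its fibre over $p\in M$ consists of the endomorphisms $Q$ of $T_pM$ with $Q^2=\mathrm{Id}$, $Q\neq\pm\mathrm{Id}$, $\dim\ker(Q-\mathrm{Id})=\dim\ker(Q+\mathrm{Id})$ and $g(QX,Y)+g(X,QY)=0$ for all $X,Y\in T_pM$. It is an embedded submanifold of the total space of $\mathrm{End}(TM)$, and $T_Q\mathcal Z=\mathcal V_Q\oplus\mathcal H_Q$, where $\mathcal H_Q=\{X^h_Q : X\in T_{\pi(Q)}M\}$ is the horizontal space of $\nabla$ and $\mathcal V_Q$, the tangent space of the fibre through $Q$, consists of the $g$-skew-symmetric endomorphisms $V$ of $T_{\pi(Q)}M$ with $VQ+QV=0$. For $i=1,2$ let $\mathcal K^i$ be the almost paracomplex structure on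 $\mathcal Z$ given at $Q$ by $$\mathcal K^iX^h_Q=(QX)^h_Q,\qquad \mathcal K^iV=(-1)^{i+1}QV\quad (V\in\mathcal V_Q),$$ and let $$\mathcal N^i(A,B)=[A,B]+[\mathcal K^iA,\mathcal K^iB]-\mathcal K^i[\mathcal K^iA,B]-\mathcal K^i[A,\mathcal K^iB]$$ be its Nijenhuis tensor. Its value on two tangent vectors at $Q$ is computed by extending them to smooth vector fields on $\mathcal Z$ near $Q$; such extensions exist and the value does not depend on them. Then, for every $Q\in\mathcal Z$, $X,Y\in T_{\pi(Q)}M$ and $V,W\in\mathcal V_Q$, $$\mathcal N^i(X^h,Y^h)_Q=R(X,Y)Q+R(QX,QY)Q-\mathcal K^i\big(R(QX,Y)Q\big)-\mathcal K^i\big(R(X,QY)Q\big),$$ $$\mathcal N^i(X^h,V)_Q=[(-1)^i+1]\,(QVX)^h_Q,\qquad \mathcal N^i(V,W)_Q=0,$$ where the endomorphisms $R(\cdot,\cdot)Q$ are regarded as vertical vectors at $Q$. -/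

import Mathlib

open Bundle
open scoped Manifold ContDiff Topology

noncomputable section

namespace ReflectorSpace

/-! ### Connections on vector bundles: vertical and horizontal lifts, connection map, curvature -/

section Bundles

variable {E : Type*} [NormedAddCommGroup E] [NormedSpace ℝ E]
  {M : Type*} [TopologicalSpace M] [ChartedSpace E M] [IsManifold 𝓘(ℝ, E) ∞ M]
  {F : Type*} [NormedAddCommGroup F] [NormedSpace ℝ F]
  {V : M → Type*} [TopologicalSpace (TotalSpace F V)]
  [∀ x, AddCommGroup (V x)] [∀ x, Module ℝ (V x)] [∀ x, TopologicalSpace (V x)]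
  [∀ x, IsTopologicalAddGroup (V x)] [∀ x, ContinuousSMul ℝ (V x)]
  [FiberBundle F V]

/-- The vertical tangent vector at the point `Q` of the total space of a vector bundle that
corresponds to the vector `v` of the fibre through `Q`: the velocity of `t ↦ Q + t v` at `0`. -/
def vertLift (Q : TotalSpace F V) (v : V Q.proj) :
    TangentSpace (𝓘(ℝ, E).prod 𝓘(ℝ, F)) Q :=
  (mfderiv 𝓘(ℝ, ℝ) (𝓘(ℝ, E).prod 𝓘(ℝ, F))
    (fun t : ℝ ↦ (⟨Q.proj, Q.snd + t • v⟩ : TotalSpace F V)) 0 : ℝ →L[ℝ] E × F) 1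

/-- The horizontal lift at `Q` of a tangent vector `X` of the base, with respect to a connection:
`X^h = dS(X) - (∇_X S)^v` for a smooth local section `S` through `Q`
(so `X^h = dS(X)` whenever `∇S` vanishes at the point). -/
def horLift (cov : CovariantDerivative 𝓘(ℝ, E) F V) (Q : TotalSpace F V)
    (X : TangentSpace 𝓘(ℝ, E) Q.proj) : TangentSpace (𝓘(ℝ, E).prod 𝓘(ℝ, F)) Q :=
  (mfderiv 𝓘(ℝ, E) (𝓘(ℝ, E).prod 𝓘(ℝ, F))
    (fun x ↦ (⟨x, FiberBundle.extend F Q.snd x⟩ : TotalSpace F V)) Q.proj : E →L[ℝ] E × F) X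
  - vertLift Q (cov (FiberBundle.extend F Q.snd) Q.proj X)

/-- The differential of the projection of the bundle onto its base. -/
def dproj (Q : TotalSpace F V) (ξ : TangentSpace (𝓘(ℝ, E).prod 𝓘(ℝ, F)) Q) :
    TangentSpace 𝓘(ℝ, E) Q.proj :=
  mfderiv (𝓘(ℝ, E).prod 𝓘(ℝ, F)) 𝓘(ℝ, E) (fun w : TotalSpace F V ↦ w.proj) Q ξ

/-- The vertical component of a tangent vector `ξ` of the total space, as a vector of the fibre:
the vector `ξ - (dπ ξ)^h` is vertical, and its fibre part is read off in the standard local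
trivialization. -/
def vertComp (cov : CovariantDerivative 𝓘(ℝ, E) F V) (Q : TotalSpace F V)
    (ξ : TangentSpace (𝓘(ℝ, E).prod 𝓘(ℝ, F)) Q) : V Q.proj :=
  (trivializationAt F V Q.proj).symm Q.proj
    ((mfderiv (𝓘(ℝ, E).prod 𝓘(ℝ, F)) 𝓘(ℝ, F)
        (fun w : TotalSpace F V ↦ (trivializationAt F V Q.proj w).2) Q :
          TangentSpace (𝓘(ℝ, E).prod 𝓘(ℝ, F)) Q →L[ℝ] F)
      (ξ - horLift cov Q (dproj Q ξ)))

/-- The curvature of a connection, with the sign convention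
`R(X,Y) = ∇_{[X,Y]} - [∇_X, ∇_Y]`, evaluated on vectors at a point (through smooth local
extensions; the value does not depend on them). -/
def curvature (cov : CovariantDerivative 𝓘(ℝ, E) F V) {p : M}
    (X Y : TangentSpace 𝓘(ℝ, E) p) (s : V p) : V p :=
  cov (FiberBundle.extend F s) p
      (VectorField.mlieBracket 𝓘(ℝ, E) (FiberBundle.extend E X) (FiberBundle.extend E Y) p)
    - (cov (fun x ↦ cov (FiberBundle.extend F s) x (FiberBundle.extend E Y x)) p X
      - cov (fun x ↦ cov (FiberBundle.extend F s) x (FiberBundle.extend E X x)) p Y)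

end Bundles

/-! ### The bundle `End(TM)` and the connection induced on it -/

section EndBundle

variable (E : Type*) [NormedAddCommGroup E] [NormedSpace ℝ E]
  (M : Type*) [TopologicalSpace M] [ChartedSpace E M]

/-- The fibre `End(T_pM)`. -/
abbrev EndT (x : M) : Type _ := TangentSpace 𝓘(ℝ, E) x →L[ℝ] TangentSpace 𝓘(ℝ, E) x

variable {E M} [IsManifold 𝓘(ℝ, E) ∞ M]

variable (E M) in
/-- The total space of `End(TM)`. -/
abbrev EndBundle : Type _ := TotalSpace (E →L[ℝ] E) (EndT E M)

theorem tensorialAt_end (cov : CovariantDerivative 𝓘(ℝ, E) E (TangentSpace 𝓘(ℝ, E) : M → Type _))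
    {S : ∀ x : M, EndT E M x} {x : M}
    (hS : MDifferentiableAt 𝓘(ℝ, E) (𝓘(ℝ, E).prod 𝓘(ℝ, E →L[ℝ] E))
      (fun y ↦ (⟨y, S y⟩ : EndBundle E M)) x) (X : TangentSpace 𝓘(ℝ, E) x) :
    TensorialAt 𝓘(ℝ, E) E
      (fun Y : (∀ y : M, TangentSpace 𝓘(ℝ, E) y) ↦
        cov (fun y ↦ S y (Y y)) x X - S x (cov Y x X)) x where
  smul {f Y} hf hY := by
    have h1 : (fun y ↦ S y ((f • Y) y)) = f • (fun y ↦ S y (Y y)) := by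
      ext y; simp
    rw [h1, cov.isCovariantDerivativeOn.leibniz (hS.clm_bundle_apply hY) hf,
      cov.isCovariantDerivativeOn.leibniz hY hf]
    simp [smul_sub]
  add {Y Y'} hY hY' := by
    have h1 : (fun y ↦ S y ((Y + Y') y)) = (fun y ↦ S y (Y y)) + (fun y ↦ S y (Y' y)) := by
      ext y; simp
    rw [h1, cov.isCovariantDerivativeOn.add (hS.clm_bundle_apply hY) (hS.clm_bundle_apply hY'),
      cov.isCovariantDerivativeOn.add hY hY']
    simp
    abel

variable [FiniteDimensional ℝ E]

instance (x : M) : FiniteDimensional ℝ (TangentSpace 𝓘(ℝ, E) x) :=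
  inferInstanceAs (FiniteDimensional ℝ E)

instance (x : M) : T2Space (TangentSpace 𝓘(ℝ, E) x) := inferInstanceAs (T2Space E)

open Classical in
/-- `(∇_X S)(Y) = ∇_X (S Y) - S (∇_X Y)` at the point `x`, for a section `S` of `End(TM)`
differentiable at `x` (and `0`, a junk value, otherwise). -/
def endCovAux (cov : CovariantDerivative 𝓘(ℝ, E) E (TangentSpace 𝓘(ℝ, E) : M → Type _))
    (S : ∀ x : M, EndT E M x) (x : M) : TangentSpace 𝓘(ℝ, E) x →L[ℝ] EndT E M x :=
  if hS : MDifferentiableAt 𝓘(ℝ, E) (𝓘(ℝ, E).prod 𝓘(ℝ, E →L[ℝ] E))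
      (fun y ↦ (⟨y, S y⟩ : EndBundle E M)) x then
    LinearMap.toContinuousLinearMap
      { toFun := fun X ↦ TensorialAt.mkHom _ x (tensorialAt_end cov hS X)
        map_add' := fun X X' ↦ by
          ext v
          simp only [TensorialAt.mkHom_apply_eq_extend, add_apply, map_add]
          abel
        map_smul' := fun c X ↦ by
          ext v
          simp only [TensorialAt.mkHom_apply_eq_extend, smul_apply, map_smul,
            smul_sub, RingHom.id_apply] }
  else 0

theorem endCovAux_apply
    (cov : CovariantDerivative 𝓘(ℝ, E) E (TangentSpace 𝓘(ℝ, E) : M → Type _))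
    {S : ∀ x : M, EndT E M x} {x : M}
    (hS : MDifferentiableAt 𝓘(ℝ, E) (𝓘(ℝ, E).prod 𝓘(ℝ, E →L[ℝ] E))
      (fun y ↦ (⟨y, S y⟩ : EndBundle E M)) x)
    (X Y : TangentSpace 𝓘(ℝ, E) x) :
    endCovAux cov S x X Y =
      cov (fun y ↦ S y (FiberBundle.extend E Y y)) x X - S x (cov (FiberBundle.extend E Y) x X) := by
  rw [endCovAux, dif_pos hS]
  exact TensorialAt.mkHom_apply_eq_extend (tensorialAt_end cov hS X) Y

/-- The connection on `End(TM)` induced by a connection on `TM`. -/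
def endCov (cov : CovariantDerivative 𝓘(ℝ, E) E (TangentSpace 𝓘(ℝ, E) : M → Type _)) :
    CovariantDerivative 𝓘(ℝ, E) (E →L[ℝ] E) (EndT E M) where
  toFun := endCovAux cov
  isCovariantDerivativeOnUniv :=
    { add := fun {S S' x} hS hS' _ ↦ by
        ext X Y
        have hY := FiberBundle.mdifferentiableAt_extend 𝓘(ℝ, E) E Y
        have h1 : (fun y ↦ (S + S') y (FiberBundle.extend E Y y)) =
            (fun y ↦ S y (FiberBundle.extend E Y y)) +
              (fun y ↦ S' y (FiberBundle.extend E Y y)) := by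
          ext y; simp
        simp only [add_apply]
        rw [endCovAux_apply cov (mdifferentiableAt_add_section hS hS'), endCovAux_apply cov hS,
          endCovAux_apply cov hS', h1,
          cov.isCovariantDerivativeOn.add (hS.clm_bundle_apply hY) (hS'.clm_bundle_apply hY)]
        simp
        abel
      leibniz := fun {S f x} hS hf _ ↦ by
        ext X Y
        have hY := FiberBundle.mdifferentiableAt_extend 𝓘(ℝ, E) E Y
        have h1 : (fun y ↦ (f • S) y (FiberBundle.extend E Y y)) =
            f • (fun y ↦ S y (FiberBundle.extend E Y y)) := by
          ext y; simp
        simp only [add_apply, smul_apply]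
        rw [endCovAux_apply cov (hf.smul_section hS), endCovAux_apply cov hS, h1,
          cov.isCovariantDerivativeOn.leibniz (hS.clm_bundle_apply hY) hf]
        simp [smul_sub]
        abel }

end EndBundle

/-! ### Neutral metrics, the Levi-Civita connection, the reflector space -/

section Reflector

variable {E : Type*} [NormedAddCommGroup E] [NormedSpace ℝ E] [FiniteDimensional ℝ E]
  {M : Type*} [TopologicalSpace M] [ChartedSpace E M] [IsManifold 𝓘(ℝ, E) ∞ M] {n : ℕ}

variable (E M n) in
/-- A smooth pseudo-Riemannian metric of neutral signature `(n, n)` on `M`. -/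
structure NeutralMetric where
  /-- The bilinear form `g_p` on `T_pM`. -/
  form (p : M) : TangentSpace 𝓘(ℝ, E) p →L[ℝ] TangentSpace 𝓘(ℝ, E) p →L[ℝ] ℝ
  symm (p : M) (X Y : TangentSpace 𝓘(ℝ, E) p) : form p X Y = form p Y X
  neutral (p : M) : ∃ e : Module.Basis (Fin n ⊕ Fin n) ℝ (TangentSpace 𝓘(ℝ, E) p),
    (∀ j k, form p (e (Sum.inl j)) (e (Sum.inl k)) = if j = k then 1 else 0) ∧
    (∀ j k, form p (e (Sum.inr j)) (e (Sum.inr k)) = if j = k then -1 else 0) ∧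
    (∀ j k, form p (e (Sum.inl j)) (e (Sum.inr k)) = 0)
  contMDiff : ContMDiff 𝓘(ℝ, E) (𝓘(ℝ, E).prod 𝓘(ℝ, E →L[ℝ] E →L[ℝ] ℝ)) ∞
    (fun p ↦ TotalSpace.mk' (E →L[ℝ] E →L[ℝ] ℝ) p (form p))

/-- `cov` is the Levi-Civita connection of `g`: smooth, torsion-free and metric. -/
structure IsLeviCivita (g : NeutralMetric E M n)
    (cov : CovariantDerivative 𝓘(ℝ, E) E (TangentSpace 𝓘(ℝ, E) : M → Type _)) : Prop where
  smooth : CovariantDerivative.ContMDiffCovariantDerivative cov ∞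
  torsion_free : cov.torsion = 0
  metric : ∀ (p : M) (X : TangentSpace 𝓘(ℝ, E) p) (Y Z : ∀ x : M, TangentSpace 𝓘(ℝ, E) x),
    MDifferentiableAt 𝓘(ℝ, E) (𝓘(ℝ, E).prod 𝓘(ℝ, E))
      (fun x ↦ (⟨x, Y x⟩ : TotalSpace E (TangentSpace 𝓘(ℝ, E) : M → Type _))) p →
    MDifferentiableAt 𝓘(ℝ, E) (𝓘(ℝ, E).prod 𝓘(ℝ, E))
      (fun x ↦ (⟨x, Z x⟩ : TotalSpace E (TangentSpace 𝓘(ℝ, E) : M → Type _))) p →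
    mfderiv 𝓘(ℝ, E) 𝓘(ℝ, ℝ) (fun x ↦ g.form x (Y x) (Z x)) p X =
      g.form p (cov Y p X) (Z p) + g.form p (Y p) (cov Z p X)

/-- `K` is skew-symmetric with respect to `g_p`. -/
def IsSkew (g : NeutralMetric E M n) {p : M} (K : EndT E M p) : Prop :=
  ∀ X Y : TangentSpace 𝓘(ℝ, E) p, g.form p (K X) Y + g.form p X (K Y) = 0

/-- Paracomplex structures on `T_pM`: `K² = Id`, `K ≠ ± Id`, and the eigenspaces for the
eigenvalues `1` and `-1` have the same dimension. -/
def IsParacomplex {p : M} (K : EndT E M p) : Prop :=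
  (∀ X, K (K X) = X) ∧ K ≠ ContinuousLinearMap.id ℝ _ ∧ K ≠ -ContinuousLinearMap.id ℝ _ ∧
  Module.finrank ℝ (Module.End.eigenspace (K : Module.End ℝ (TangentSpace 𝓘(ℝ, E) p)) 1) =
    Module.finrank ℝ (Module.End.eigenspace (K : Module.End ℝ (TangentSpace 𝓘(ℝ, E) p)) (-1))

/-- The reflector space `𝒵` of `(M, g)`, as a subset of the total space of `End(TM)`. -/
def reflectorSpace (g : NeutralMetric E M n) : Set (EndBundle E M) :=
  {Q | IsParacomplex Q.snd ∧ IsSkew g Q.snd}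

/-- The vertical space `𝒱_Q` of `𝒵` at `Q`: the tangent space at `Q` of the fibre of `𝒵`, which
consists of the skew-symmetric endomorphisms anti-commuting with `Q`. -/
def verticalSpace (g : NeutralMetric E M n) (Q : EndBundle E M) : Set (EndT E M Q.proj) :=
  {V | IsSkew g V ∧ ∀ X, V (Q.snd X) + Q.snd (V X) = 0}

/-- Tangent vectors of `End(TM)`. -/
abbrev TEnd (Q : EndBundle E M) : Type _ := TangentSpace (𝓘(ℝ, E).prod 𝓘(ℝ, E →L[ℝ] E)) Q

/-- The horizontal lift `X^h_Q`, with respect to the connection on `End(TM)` induced by a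
connection on `TM`. -/
def hLift (cov : CovariantDerivative 𝓘(ℝ, E) E (TangentSpace 𝓘(ℝ, E) : M → Type _))
    (Q : EndBundle E M) (X : TangentSpace 𝓘(ℝ, E) Q.proj) : TEnd Q :=
  horLift (endCov cov) Q X

/-- An endomorphism of `T_pM` as a vertical tangent vector of `End(TM)` at `Q`. -/
def vLift (Q : EndBundle E M) (V : EndT E M Q.proj) : TEnd Q := vertLift Q V

/-- The tangent space `T_Q𝒵 = 𝒱_Q ⊕ ℋ_Q`, at `Q ∈ 𝒵`: all `X^h + V` with `X ∈ T_pM` and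
`V ∈ 𝒱_Q`. -/
def tangentZ (g : NeutralMetric E M n)
    (cov : CovariantDerivative 𝓘(ℝ, E) E (TangentSpace 𝓘(ℝ, E) : M → Type _))
    (Q : EndBundle E M) : Set (TEnd Q) :=
  {ξ | ∃ X, ∃ V ∈ verticalSpace g Q, ξ = hLift cov Q X + vLift Q V}

/-- The structure `𝒦^i`: `𝒦^i X^h = (QX)^h` and `𝒦^i V = (-1)^{i+1} Q V` at the point `Q`.
The same formulas make sense on all of `End(TM)`; only points of `𝒵` and vectors tangent to `𝒵`
matter. -/
def paraK (cov : CovariantDerivative 𝓘(ℝ, E) E (TangentSpace 𝓘(ℝ, E) : M → Type _)) (i : ℕ)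
    (Q : EndBundle E M) (ξ : TEnd Q) : TEnd Q :=
  hLift cov Q (Q.snd (dproj Q ξ)) +
    vLift Q ((-1 : ℝ) ^ (i + 1) • (Q.snd ∘L vertComp (endCov cov) Q ξ))

/-- `𝒜`, defined on the open subset `U` of `End(TM)`, is smooth and tangent to `𝒵` along `𝒵`,
so that it restricts to a smooth vector field on the open subset `𝒵 ∩ U` of `𝒵`. -/
def IsTangentField (g : NeutralMetric E M n)
    (cov : CovariantDerivative 𝓘(ℝ, E) E (TangentSpace 𝓘(ℝ, E) : M → Type _))
    (U : Set (EndBundle E M)) (𝒜 : ∀ Q : EndBundle E M, TEnd Q) : Prop :=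
  ContMDiffOn (𝓘(ℝ, E).prod 𝓘(ℝ, E →L[ℝ] E))
    ((𝓘(ℝ, E).prod 𝓘(ℝ, E →L[ℝ] E)).prod 𝓘(ℝ, E × (E →L[ℝ] E))) ∞
    (fun Q ↦ (⟨Q, 𝒜 Q⟩ : TangentBundle (𝓘(ℝ, E).prod 𝓘(ℝ, E →L[ℝ] E)) (EndBundle E M))) U ∧
  ∀ Q ∈ U ∩ reflectorSpace g, 𝒜 Q ∈ tangentZ g cov Q

/-- Lie bracket of vector fields on `End(TM)`. The bracket of two vector fields on the embedded
submanifold `𝒵` is the restriction of the bracket of any smooth extensions. -/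
def bracket (𝒜 ℬ : ∀ Q : EndBundle E M, TEnd Q) (Q : EndBundle E M) : TEnd Q :=
  VectorField.mlieBracket (𝓘(ℝ, E).prod 𝓘(ℝ, E →L[ℝ] E)) 𝒜 ℬ Q

/-- `[𝒜,ℬ] + [𝒦^i𝒜,𝒦^iℬ] - 𝒦^i[𝒦^i𝒜,ℬ] - 𝒦^i[𝒜,𝒦^iℬ]` at the point `Q`. -/
def nijenhuis (cov : CovariantDerivative 𝓘(ℝ, E) E (TangentSpace 𝓘(ℝ, E) : M → Type _)) (i : ℕ)
    (𝒜 ℬ : ∀ Q : EndBundle E M, TEnd Q) (Q : EndBundle E M) : TEnd Q :=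
  bracket 𝒜 ℬ Q
    + bracket (fun P ↦ paraK cov i P (𝒜 P)) (fun P ↦ paraK cov i P (ℬ P)) Q
    - paraK cov i Q (bracket (fun P ↦ paraK cov i P (𝒜 P)) ℬ Q)
    - paraK cov i Q (bracket 𝒜 (fun P ↦ paraK cov i P (ℬ P)) Q)

/-- The Nijenhuis tensor `𝒩^i` of `𝒦^i` on `𝒵` satisfies `𝒩^i(ξ, η)_Q = ζ`: the vectors `ξ, η`
extend to local vector fields on `𝒵` near `Q`, and the Nijenhuis expression takes the value `ζ`
at `Q` for every choice of such extensions. -/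
def HasNijenhuisValue (g : NeutralMetric E M n)
    (cov : CovariantDerivative 𝓘(ℝ, E) E (TangentSpace 𝓘(ℝ, E) : M → Type _)) (i : ℕ)
    (Q : EndBundle E M) (ξ η ζ : TEnd Q) : Prop :=
  (∃ (U : Set (EndBundle E M)) (𝒜 ℬ : ∀ P : EndBundle E M, TEnd P), IsOpen U ∧ Q ∈ U ∧
    IsTangentField g cov U 𝒜 ∧ IsTangentField g cov U ℬ ∧ 𝒜 Q = ξ ∧ ℬ Q = η) ∧
  ∀ (U : Set (EndBundle E M)) (𝒜 ℬ : ∀ P : EndBundle E M, TEnd P), IsOpen U → Q ∈ U →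
    IsTangentField g cov U 𝒜 → IsTangentField g cov U ℬ → 𝒜 Q = ξ → ℬ Q = η →
    nijenhuis cov i 𝒜 ℬ Q = ζ

end Reflector

end ReflectorSpace

end

noncomputable section

namespace ReflectorSpace

variable {E : Type*} [NormedAddCommGroup E] [NormedSpace ℝ E]
  {M : Type*} [TopologicalSpace M] [ChartedSpace E M]

/-! ### Connections on the tangent bundle in coordinates -/

section TangentCoordinates

/-! In the chart of `End(TM)` induced by a chart of `M`, a tangent vector at a point with fibre
coordinate `P` is a pair `(x, A)` in `E × End(E)`. With Christoffel symbols `Γ`, the horizontal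
vectors are `(x, -[Γ(x), P])` and the vertical ones `(0, A)`. So `𝒦^i` becomes an explicit field `K`
of endomorphisms built from `P` and `Γ` (`paraMap`, with `ε = (-1)^(i+1)`; see `chartDeriv_paraK`).

The formula for `K` makes sense on all of `End(TM)`, whereas `K² = 1` is available only where `P² =
1`. This is enough. Expand the four brackets by the product rule: the derivatives of the two fields
cancel in pairs or come multiplied by `1 - K²` at the point, and what is left is `dK(Ka) b - dK(Kb)
a + K(dK(b) a) - K(dK(a) b)` (`nijenhuis_vectorSpace`). Hence the value depends only on the two
vectors, even for extensions off `𝒵`, and all brackets can be taken in the ambient space.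

It remains to differentiate `K` (`fderiv_paraMap`) and substitute. For two vertical vectors
everything cancels. In the mixed case the derivative of `P` in a vertical direction `B` is `B`,
which produces the factor `1 - ε = (-1)^i + 1`. For two horizontal vectors the symmetry of `Γ` (zero
torsion) kills the base component, and the fibre component collects `dΓ` and the double commutators
into the curvature of `d + [Γ, ·]` (`paraMapNijenhuis_horizontal`, `endCoord_curvature`).

Extensions tangent to `𝒵` are explicit: horizontal lifts of coordinate fields, and `½(S - PSP)` for
a skew section `S` (`exists_skew_section`). -/

theorem mvfderiv_congr {F : Type*} [NormedAddCommGroup F] [NormedSpace ℝ F] {f f' : M → F} {x : M}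
    (h : f =ᶠ[𝓝 x] f') : mvfderiv 𝓘(ℝ, E) f x = mvfderiv 𝓘(ℝ, E) f' x := by
  have := h.mfderiv_eq (I := 𝓘(ℝ, E)) (I' := 𝓘(ℝ, F))
  ext v
  exact congr($this v)

theorem mvfderiv_comp_fderiv {F G : Type*} [NormedAddCommGroup F] [NormedSpace ℝ F]
    [NormedAddCommGroup G] [NormedSpace ℝ G] {f : M → F} {k : F → G} {x : M}
    (hk : DifferentiableAt ℝ k (f x)) (hf : MDifferentiableAt 𝓘(ℝ, E) 𝓘(ℝ, F) f x)
    (X : TangentSpace 𝓘(ℝ, E) x) :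
    mvfderiv 𝓘(ℝ, E) (fun y ↦ k (f y)) x X = fderiv ℝ k (f x) (mvfderiv 𝓘(ℝ, E) f x X) := by
  have := mfderiv_comp_apply x hk.mdifferentiableAt hf X
  rw [mfderiv_eq_fderiv] at this
  exact this

variable [IsManifold 𝓘(ℝ, E) ∞ M]

/-- The tangent space at `x`, read in the chart centred at `p`. -/
def tangentCoord (p x : M) : TangentSpace 𝓘(ℝ, E) x →L[ℝ] E :=
  (trivializationAt E (TangentSpace 𝓘(ℝ, E) : M → Type _) p).continuousLinearMapAt ℝ x

/-- The coordinate vector fields of the chart centred at `p`. -/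
def coordVec (p x : M) : E →L[ℝ] TangentSpace 𝓘(ℝ, E) x :=
  (trivializationAt E (TangentSpace 𝓘(ℝ, E) : M → Type _) p).symmL ℝ x

theorem mem_baseSet_iff {p x : M} :
    x ∈ (trivializationAt E (TangentSpace 𝓘(ℝ, E) : M → Type _) p).baseSet ↔
      x ∈ (chartAt E p).source := Iff.rfl

theorem coordVec_tangentCoord {p x : M} (hx : x ∈ (chartAt E p).source)
    (v : TangentSpace 𝓘(ℝ, E) x) : coordVec p x (tangentCoord p x v) = v :=
  Trivialization.symmL_continuousLinearMapAt _ hx v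

theorem tangentCoord_coordVec {p x : M} (hx : x ∈ (chartAt E p).source) (v : E) :
    tangentCoord p x (coordVec p x v) = v :=
  Trivialization.continuousLinearMapAt_symmL _ hx v

theorem trivializationAt_snd {p x : M} (hx : x ∈ (chartAt E p).source)
    (v : TangentSpace 𝓘(ℝ, E) x) :
    (trivializationAt E (TangentSpace 𝓘(ℝ, E) : M → Type _) p ⟨x, v⟩).2 = tangentCoord p x v :=
  (Trivialization.continuousLinearMapAt_apply_of_mem ℝ _ hx v).symm

theorem tangentCoord_eq_mfderiv {p x : M} (hx : x ∈ (chartAt E p).source) :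
    tangentCoord p x = mfderiv 𝓘(ℝ, E) 𝓘(ℝ, E) (extChartAt 𝓘(ℝ, E) p) x :=
  TangentBundle.continuousLinearMapAt_trivializationAt hx

theorem mdifferentiableAt_section_iff_tangentCoord {p x : M} (hx : x ∈ (chartAt E p).source)
    {Y : ∀ y : M, TangentSpace 𝓘(ℝ, E) y} :
    MDifferentiableAt 𝓘(ℝ, E) (𝓘(ℝ, E).prod 𝓘(ℝ, E))
      (fun y ↦ (⟨y, Y y⟩ : TotalSpace E (TangentSpace 𝓘(ℝ, E) : M → Type _))) x ↔
    MDifferentiableAt 𝓘(ℝ, E) 𝓘(ℝ, E) (fun y ↦ tangentCoord p y (Y y)) x := by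
  rw [(trivializationAt E (TangentSpace 𝓘(ℝ, E) : M → Type _) p).mdifferentiableAt_section_iff
    𝓘(ℝ, E) Y hx]
  apply Filter.EventuallyEq.mdifferentiableAt_iff
  filter_upwards [(chartAt E p).open_source.mem_nhds hx] with y hy
  exact trivializationAt_snd hy _

theorem mdifferentiableAt_coordVec {p x : M} (hx : x ∈ (chartAt E p).source) (v : E) :
    MDifferentiableAt 𝓘(ℝ, E) (𝓘(ℝ, E).prod 𝓘(ℝ, E))
      (fun y ↦ (⟨y, coordVec p y v⟩ : TotalSpace E (TangentSpace 𝓘(ℝ, E) : M → Type _))) x := by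
  rw [mdifferentiableAt_section_iff_tangentCoord hx]
  refine (mdifferentiableAt_const (c := v)).congr_of_eventuallyEq ?_
  filter_upwards [(chartAt E p).open_source.mem_nhds hx] with y hy
  exact tangentCoord_coordVec hy v

/-! ### Christoffel symbols: the difference between a connection and the coordinate derivative -/

section Christoffel

variable (cov : CovariantDerivative 𝓘(ℝ, E) E (TangentSpace 𝓘(ℝ, E) : M → Type _))

/-- The connection and the coordinate derivative satisfy the same Leibniz rule, so the derivative of
the coefficient drops out of their difference. -/
theorem tensorialAt_cov_sub_mvfderiv {p x : M} (hx : x ∈ (chartAt E p).source)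
    (X : TangentSpace 𝓘(ℝ, E) x) :
    TensorialAt 𝓘(ℝ, E) E (fun Y : (∀ y : M, TangentSpace 𝓘(ℝ, E) y) ↦
      tangentCoord p x (cov Y x X) -
        mvfderiv 𝓘(ℝ, E) (fun y ↦ tangentCoord p y (Y y)) x X) x where
  smul {f Y} hf hY := by
    have hY' := (mdifferentiableAt_section_iff_tangentCoord hx).1 hY
    have h1 : (fun y ↦ tangentCoord p y ((f • Y) y)) =
        f • (fun y ↦ tangentCoord p y (Y y)) := by
      ext y; simp
    rw [cov.isCovariantDerivativeOn.leibniz hY hf, h1, mvfderiv_smul hf hY']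
    simp [smul_sub]
  add {Y Y'} hY hY' := by
    have k := (mdifferentiableAt_section_iff_tangentCoord hx).1 hY
    have k' := (mdifferentiableAt_section_iff_tangentCoord hx).1 hY'
    have h1 : (fun y ↦ tangentCoord p y ((Y + Y') y)) =
        (fun y ↦ tangentCoord p y (Y y)) + (fun y ↦ tangentCoord p y (Y' y)) := by
      ext y; simp
    rw [cov.isCovariantDerivativeOn.add hY hY', h1, mvfderiv_add k k']
    simp
    abel

theorem mvfderiv_tangentCoord_coordVec {p x : M} (hx : x ∈ (chartAt E p).source) (v : E) :
    mvfderiv 𝓘(ℝ, E) (fun y ↦ tangentCoord p y (coordVec p y v)) x = 0 := by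
  rw [← mvfderiv_const v (I := 𝓘(ℝ, E))]
  apply mvfderiv_congr
  filter_upwards [(chartAt E p).open_source.mem_nhds hx] with y hy
  exact tangentCoord_coordVec hy v

variable [FiniteDimensional ℝ E]

/-- The Christoffel symbols of a connection in the chart centred at `p`: the coordinates at `x` of
`∇_u v` for coordinate fields `u`, `v`. -/
def christoffel (p x : M) : E →L[ℝ] E →L[ℝ] E :=
  ∑ j, (ContinuousLinearMap.smulRightL ℝ E E
      (LinearMap.toContinuousLinearMap ((Module.finBasis ℝ E).coord j))) ∘L
    (tangentCoord p x ∘L cov (fun y ↦ coordVec p y (Module.finBasis ℝ E j)) x ∘L coordVec p x)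

/-- A connection in coordinates: `∇ = d + Γ`. -/
theorem tangentCoord_cov {p x : M} (hx : x ∈ (chartAt E p).source)
    {Y : ∀ y : M, TangentSpace 𝓘(ℝ, E) y}
    (hY : MDifferentiableAt 𝓘(ℝ, E) (𝓘(ℝ, E).prod 𝓘(ℝ, E))
      (fun y ↦ (⟨y, Y y⟩ : TotalSpace E (TangentSpace 𝓘(ℝ, E) : M → Type _))) x)
    (X : TangentSpace 𝓘(ℝ, E) x) :
    tangentCoord p x (cov Y x X) =
      mvfderiv 𝓘(ℝ, E) (fun y ↦ tangentCoord p y (Y y)) x X +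
        christoffel cov p x (tangentCoord p x X) (tangentCoord p x (Y x)) := by
  have T := tensorialAt_cov_sub_mvfderiv cov hx X
  set b := Module.finBasis ℝ E
  set c : Fin (Module.finrank ℝ E) → ℝ := fun j ↦ b.coord j (tangentCoord p x (Y x)) with hc
  have hs : ∀ j ∈ Finset.univ, MDifferentiableAt 𝓘(ℝ, E) (𝓘(ℝ, E).prod 𝓘(ℝ, E))
      (fun y ↦ (⟨y, ((fun _ : M ↦ c j) • fun y ↦ coordVec p y (b j)) y⟩ :
        TotalSpace E (TangentSpace 𝓘(ℝ, E) : M → Type _))) x :=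
    fun j _ ↦ mdifferentiableAt_const.smul_section (mdifferentiableAt_coordVec hx (b j))
  have hYx : Y x = ∑ j, ((fun _ : M ↦ c j) • fun y ↦ coordVec p y (b j)) x := by
    simp only [Pi.smul_apply', ← map_smul, ← map_sum]
    rw [← coordVec_tangentCoord hx (Y x)]
    congr 1
    exact (b.sum_repr _).symm
  -- By tensoriality `Y` may be replaced by the combination of coordinate fields whose coefficients
  -- `c j` are frozen at `x`.
  have key := T.pointwise hY (.sum_section hs) hYx
  beta_reduce at key
  rw [T.sum _ hs] at key
  rw [← sub_eq_iff_eq_add', key]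
  simp only [christoffel, sum_apply]
  refine Finset.sum_congr rfl fun j _ ↦ ?_
  have := T.smul (f := fun _ ↦ c j) mdifferentiableAt_const (mdifferentiableAt_coordVec hx (b j))
  beta_reduce at this
  rw [this, mvfderiv_tangentCoord_coordVec hx]
  simp [coordVec_tangentCoord hx, hc, b]

end Christoffel

end TangentCoordinates

/-! ### Vector fields in a chart -/

section VectorFields

section Bracket

variable {E' : Type*} [NormedAddCommGroup E'] [NormedSpace ℝ E']
  {H : Type*} [TopologicalSpace H]
  {I : ModelWithCorners ℝ E' H}
  {N : Type*} [TopologicalSpace N]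
  [ChartedSpace H N]

/-- The tangent space at `y`, read in the preferred chart at `x`. -/
def chartDeriv (I : ModelWithCorners ℝ E' H) (x y : N) : TangentSpace I y →L[ℝ] E' :=
  mfderiv I 𝓘(ℝ, E') (extChartAt I x) y

/-- A vector field in the preferred chart at `x`. -/
def fieldInChart (I : ModelWithCorners ℝ E' H) (x : N) (A : ∀ y : N, TangentSpace I y) (z : E') :
    E' :=
  chartDeriv I x ((extChartAt I x).symm z) (A ((extChartAt I x).symm z))

variable [IsManifold I ∞ N]

theorem isInvertible_chartDeriv {x y : N} (hy : y ∈ (extChartAt I x).source) :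
    (chartDeriv I x y).IsInvertible :=
  have : IsManifold I 1 N := .of_le (n := ∞) (by simp)
  isInvertible_mfderiv_extChartAt hy

theorem chartDeriv_injective {x y : N} (hy : y ∈ (extChartAt I x).source) :
    Function.Injective (chartDeriv I x y) := by
  obtain ⟨e, he⟩ := isInvertible_chartDeriv (I := I) hy
  rw [← he]
  exact e.injective

theorem contMDiffAt_field_iff {x y : N} (hy : y ∈ (chartAt H x).source)
    {A : ∀ y : N, TangentSpace I y} :
    ContMDiffAt I (I.prod 𝓘(ℝ, E')) ∞ (fun y ↦ (⟨y, A y⟩ : TangentBundle I N)) y ↔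
      ContMDiffAt I 𝓘(ℝ, E') ∞ (fun y ↦ chartDeriv I x y (A y)) y := by
  have : IsManifold I 1 N := .of_le (n := ∞) (by simp)
  have : ContMDiffVectorBundle ∞ E' (TangentSpace I : N → Type _) I :=
    have : IsManifold I (∞ + 1) N := inferInstanceAs (IsManifold I ∞ N)
    TangentBundle.contMDiffVectorBundle
  rw [(trivializationAt E' (TangentSpace I : N → Type _) x).contMDiffAt_section_iff hy]
  apply Filter.EventuallyEq.contMDiffAt_iff
  filter_upwards [(chartAt H x).open_source.mem_nhds hy] with z hz
  rw [chartDeriv, ← TangentBundle.continuousLinearMapAt_trivializationAt hz]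
  exact (Trivialization.continuousLinearMapAt_apply_of_mem ℝ _ hz _).symm

variable [I.Boundaryless]

theorem differentiableAt_fieldInChart {x : N} {A : ∀ y : N, TangentSpace I y}
    (hA : ContMDiffAt I (I.prod 𝓘(ℝ, E')) ∞ (fun y ↦ (⟨y, A y⟩ : TangentBundle I N)) x) :
    DifferentiableAt ℝ (fieldInChart I x A) (extChartAt I x x) := by
  rw [contMDiffAt_field_iff (mem_chart_source H x)] at hA
  have hs : ContMDiffAt 𝓘(ℝ, E') I ∞ (extChartAt I x).symm (extChartAt I x x) :=
    (contMDiffOn_extChartAt_symm x).contMDiffAt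
      ((isOpen_extChartAt_target x).mem_nhds (mem_extChartAt_target x))
  have := hA.comp_of_eq hs (extChartAt_to_inv x)
  exact this.contDiffAt.differentiableAt (by simp)

/-- The manifold bracket is defined by pulling both fields back along the inverse chart. On the
chart target this pullback is `fieldInChart`, because the derivatives of the chart and of its
inverse are mutually inverse. Without boundary the model has full range, so brackets within a set
become ordinary ones. -/
theorem chartDeriv_mlieBracket [CompleteSpace E'] (x : N) (A B : ∀ y : N, TangentSpace I y) :
    chartDeriv I x x (VectorField.mlieBracket I A B x) =
      VectorField.lieBracket ℝ (fieldInChart I x A) (fieldInChart I x B) (extChartAt I x x) := by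
  have : IsManifold I 1 N := .of_le (n := ∞) (by simp)
  have key : ∀ C : (∀ y : N, TangentSpace I y),
      VectorField.mpullbackWithin 𝓘(ℝ, E') I (extChartAt I x).symm C (Set.range I)
        =ᶠ[𝓝 (extChartAt I x x)] fieldInChart I x C := by
    intro C
    filter_upwards [(isOpen_extChartAt_target x).mem_nhds (mem_extChartAt_target x)] with z hz
    rw [VectorField.mpullbackWithin_apply]
    have h1 := mfderiv_extChartAt_comp_mfderivWithin_extChartAt_symm (I := I) hz
    have h2 := mfderivWithin_extChartAt_symm_comp_mfderiv_extChartAt (I := I) hz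
    rw [ContinuousLinearMap.inverse_eq h2 h1]
    rfl
  have h1 : VectorField.mlieBracket I A B x = (chartDeriv I x x).inverse
      (VectorField.lieBracket ℝ (fieldInChart I x A) (fieldInChart I x B) (extChartAt I x x)) := by
    rw [← VectorField.mlieBracketWithin_univ, VectorField.mlieBracketWithin_apply]
    have h2 := (key A).lieBracket_vectorField_eq (𝕜 := ℝ) (key B)
    have h3 : ∀ V W : E' → E', VectorField.lieBracketWithin ℝ V W
        ((extChartAt I x).symm ⁻¹' Set.univ ∩ Set.range I) (extChartAt I x x) =
          VectorField.lieBracket ℝ V W (extChartAt I x x) := by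
      intro V W
      rw [I.range_eq_univ, Set.preimage_univ, Set.univ_inter, VectorField.lieBracketWithin_univ]
    exact congrArg (chartDeriv I x x).inverse ((h3 _ _).trans h2)
  rw [h1]
  exact (isInvertible_chartDeriv (mem_extChartAt_source x)).self_apply_inverse _

end Bracket

end VectorFields

/-! ### The induced connection on `End(TM)` in coordinates -/

section EndCoordinates

variable [IsManifold 𝓘(ℝ, E) ∞ M]

theorem trivializationAt_hom_snd (p x : M) (A : EndT E M x) :
    (trivializationAt (E →L[ℝ] E) (EndT E M) p ⟨x, A⟩).2 =
      tangentCoord p x ∘L A ∘L coordVec p x := rfl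

theorem mem_baseSet_hom_iff {p x : M} :
    x ∈ (trivializationAt (E →L[ℝ] E) (EndT E M) p).baseSet ↔ x ∈ (chartAt E p).source := by
  rw [hom_trivializationAt_baseSet, Set.mem_inter_iff, mem_baseSet_iff, and_self]

theorem contMDiffAt_coordVec {p x : M} (hx : x ∈ (chartAt E p).source) (v : E) :
    ContMDiffAt 𝓘(ℝ, E) (𝓘(ℝ, E).prod 𝓘(ℝ, E)) ∞
      (fun y ↦ (⟨y, coordVec p y v⟩ : TotalSpace E (TangentSpace 𝓘(ℝ, E) : M → Type _))) x := by
  rw [(trivializationAt E (TangentSpace 𝓘(ℝ, E) : M → Type _) p).contMDiffAt_section_iff hx]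
  refine (contMDiffAt_const (c := v)).congr_of_eventuallyEq ?_
  filter_upwards [(chartAt E p).open_source.mem_nhds hx] with y hy
  rw [trivializationAt_snd hy, tangentCoord_coordVec hy]

/-- An endomorphism of the tangent space at `x`, read in the chart centred at `p`. -/
def endCoord (p x : M) : EndT E M x →L[ℝ] (E →L[ℝ] E) :=
  (ContinuousLinearMap.precomp E (coordVec p x)) ∘L
    (ContinuousLinearMap.postcomp (TangentSpace 𝓘(ℝ, E) x) (tangentCoord p x))

theorem endCoord_apply (p x : M) (A : EndT E M x) (v : E) :
    endCoord p x A v = tangentCoord p x (A (coordVec p x v)) := rfl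

theorem endCoord_tangentCoord {p x : M} (hx : x ∈ (chartAt E p).source) (A : EndT E M x)
    (v : TangentSpace 𝓘(ℝ, E) x) :
    endCoord p x A (tangentCoord p x v) = tangentCoord p x (A v) := by
  rw [endCoord_apply, coordVec_tangentCoord hx]

theorem trivializationAt_end_snd (p x : M) (A : EndT E M x) :
    (trivializationAt (E →L[ℝ] E) (EndT E M) p ⟨x, A⟩).2 = endCoord p x A := rfl

theorem mdifferentiableAt_end_iff {p x : M} (hx : x ∈ (chartAt E p).source)
    {S : ∀ y : M, EndT E M y} :
    MDifferentiableAt 𝓘(ℝ, E) (𝓘(ℝ, E).prod 𝓘(ℝ, E →L[ℝ] E))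
      (fun y ↦ (⟨y, S y⟩ : EndBundle E M)) x ↔
    MDifferentiableAt 𝓘(ℝ, E) 𝓘(ℝ, E →L[ℝ] E) (fun y ↦ endCoord p y (S y)) x :=
  (trivializationAt (E →L[ℝ] E) (EndT E M) p).mdifferentiableAt_section_iff
    𝓘(ℝ, E) S (mem_baseSet_hom_iff.2 hx)

variable [FiniteDimensional ℝ E]
  (cov : CovariantDerivative 𝓘(ℝ, E) E (TangentSpace 𝓘(ℝ, E) : M → Type _))

/-- Smoothness of the connection is a statement about sections smooth on all of `M`, while
coordinate fields are smooth only on the chart domain. They are therefore cut off by a bump function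
supported in the chart. -/
theorem contMDiffAt_cov_coordVec [T2Space M]
    (hcov : CovariantDerivative.ContMDiffCovariantDerivative cov ∞)
    {p x : M} (hx : x ∈ (chartAt E p).source) (v : E) :
    ContMDiffAt 𝓘(ℝ, E) 𝓘(ℝ, E →L[ℝ] E) ∞
      (fun y ↦ tangentCoord p y ∘L cov (fun z ↦ coordVec p z v) y ∘L coordVec p y) x := by
  obtain ⟨f, -, hf⟩ := (SmoothBumpFunction.nhds_basis_tsupport (I := 𝓘(ℝ, E)) x).mem_iff.1
    ((chartAt E p).open_source.mem_nhds hx)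
  set σ : ∀ y : M, TangentSpace 𝓘(ℝ, E) y := (f : M → ℝ) • fun z ↦ coordVec p z v with hσ
  have h1 : ContMDiff 𝓘(ℝ, E) (𝓘(ℝ, E).prod 𝓘(ℝ, E)) ∞
      (fun y ↦ (⟨y, σ y⟩ : TotalSpace E (TangentSpace 𝓘(ℝ, E) : M → Type _))) :=
    ContMDiffOn.smul_section_of_tsupport f.contMDiff.contMDiffOn (chartAt E p).open_source hf
      fun y hy ↦ (contMDiffAt_coordVec hy v).contMDiffWithinAt
  have h2 := (hcov.contMDiff.contMDiff (σ := σ) h1.contMDiffOn).contMDiffAt Filter.univ_mem (x := x)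
  have h3 := ((trivializationAt (E →L[ℝ] E) (EndT E M) p).contMDiffAt_section_iff
    (mem_baseSet_hom_iff.2 hx)).1 h2
  refine h3.congr_of_eventuallyEq ?_
  -- The bump function must equal `1` on a neighbourhood of each nearby `y`, since the connection
  -- sees the germ of the section at `y`.
  filter_upwards [(chartAt E p).open_source.mem_nhds hx, f.eventuallyEq_one.eventually_nhds]
    with y hy hfy
  rw [trivializationAt_hom_snd]
  congr 2
  refine cov.isCovariantDerivativeOn.congr_of_eventuallyEq (s := Set.univ)
    (mdifferentiableAt_coordVec hy v) (h1.contMDiffAt.mdifferentiableAt (by simp)) Filter.univ_mem ?_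
  filter_upwards [hfy] with z hz
  simp [hσ, hz]

theorem contMDiffAt_christoffel [T2Space M]
    (hcov : CovariantDerivative.ContMDiffCovariantDerivative cov ∞)
    {p x : M} (hx : x ∈ (chartAt E p).source) :
    ContMDiffAt 𝓘(ℝ, E) 𝓘(ℝ, E →L[ℝ] E →L[ℝ] E) ∞ (christoffel cov p) x := by
  unfold christoffel
  apply ContMDiffAt.sum
  intro j _
  exact contMDiffAt_const.clm_comp (contMDiffAt_cov_coordVec cov hcov hx _)

theorem mlieBracket_coordVec (p : M) (u v : E) :
    VectorField.mlieBracket 𝓘(ℝ, E) (fun y ↦ coordVec p y u) (fun y ↦ coordVec p y v) p = 0 := by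
  have h : ∀ w : E, fieldInChart 𝓘(ℝ, E) p (fun y ↦ coordVec p y w)
      =ᶠ[𝓝 (extChartAt 𝓘(ℝ, E) p p)] fun _ ↦ w := by
    intro w
    filter_upwards [(isOpen_extChartAt_target p).mem_nhds (mem_extChartAt_target p)] with z hz
    have hz' : (extChartAt 𝓘(ℝ, E) p).symm z ∈ (chartAt E p).source := by
      rw [← extChartAt_source 𝓘(ℝ, E)]
      exact (extChartAt 𝓘(ℝ, E) p).map_target hz
    rw [fieldInChart, chartDeriv, ← tangentCoord_eq_mfderiv hz', tangentCoord_coordVec hz']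
  apply chartDeriv_injective (I := 𝓘(ℝ, E)) (mem_extChartAt_source p)
  rw [chartDeriv_mlieBracket, (h u).lieBracket_vectorField_eq (h v), map_zero]
  simp [VectorField.lieBracket]

/-- Coordinate fields commute, so their torsion is the antisymmetric part of the Christoffel
symbols. -/
theorem christoffel_symm (htor : cov.torsion = 0) (p : M) (u v : E) :
    christoffel cov p p u v = christoffel cov p p v u := by
  have hx := mem_chart_source E p
  have h := cov.torsion_apply (mdifferentiableAt_coordVec hx u) (mdifferentiableAt_coordVec hx v)
  rw [htor, mlieBracket_coordVec, sub_zero] at h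
  have h' := congrArg (tangentCoord p p) h
  simp only [map_sub] at h'
  rw [tangentCoord_cov cov hx (mdifferentiableAt_coordVec hx v),
    tangentCoord_cov cov hx (mdifferentiableAt_coordVec hx u),
    mvfderiv_tangentCoord_coordVec hx, mvfderiv_tangentCoord_coordVec hx] at h'
  simp [tangentCoord_coordVec hx] at h'
  exact (sub_eq_zero.1 h'.symm)

theorem endCov_apply {S : ∀ y : M, EndT E M y} {x : M}
    (hS : MDifferentiableAt 𝓘(ℝ, E) (𝓘(ℝ, E).prod 𝓘(ℝ, E →L[ℝ] E))
      (fun y ↦ (⟨y, S y⟩ : EndBundle E M)) x)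
    {Y : ∀ y : M, TangentSpace 𝓘(ℝ, E) y}
    (hY : MDifferentiableAt 𝓘(ℝ, E) (𝓘(ℝ, E).prod 𝓘(ℝ, E))
      (fun y ↦ (⟨y, Y y⟩ : TotalSpace E (TangentSpace 𝓘(ℝ, E) : M → Type _))) x)
    (X : TangentSpace 𝓘(ℝ, E) x) :
    endCov cov S x X (Y x) = cov (fun y ↦ S y (Y y)) x X - S x (cov Y x X) := by
  change endCovAux cov S x X (Y x) = _
  rw [endCovAux, dif_pos hS]
  exact TensorialAt.mkHom_apply (tensorialAt_end cov hS X) hY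

/-- The induced connection on `End(TM)` in coordinates: `∇ = d + [Γ, ·]`. -/
theorem endCoord_endCov {p x : M} (hx : x ∈ (chartAt E p).source) {S : ∀ y : M, EndT E M y}
    (hS : MDifferentiableAt 𝓘(ℝ, E) (𝓘(ℝ, E).prod 𝓘(ℝ, E →L[ℝ] E))
      (fun y ↦ (⟨y, S y⟩ : EndBundle E M)) x)
    (X : TangentSpace 𝓘(ℝ, E) x) :
    endCoord p x (endCov cov S x X) =
      mvfderiv 𝓘(ℝ, E) (fun y ↦ endCoord p y (S y)) x X +
        (christoffel cov p x (tangentCoord p x X) ∘L endCoord p x (S x) -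
          endCoord p x (S x) ∘L christoffel cov p x (tangentCoord p x X)) := by
  have hS' := (mdifferentiableAt_end_iff hx).1 hS
  ext v
  have hv := mdifferentiableAt_coordVec hx v
  have hSv := hS.clm_bundle_apply hv
  rw [endCoord_apply, endCov_apply cov hS hv, map_sub, tangentCoord_cov cov hx hSv,
    ← endCoord_tangentCoord hx (S x) (cov _ x X), tangentCoord_cov cov hx hv,
    mvfderiv_tangentCoord_coordVec hx]
  -- Evaluation at the fixed vector `v` is linear, so it commutes with the derivative.
  have h2 : mvfderiv 𝓘(ℝ, E) (fun y ↦ tangentCoord p y (S y (coordVec p y v))) x X =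
      mvfderiv 𝓘(ℝ, E) (fun y ↦ endCoord p y (S y)) x X v :=
    (mvfderiv_comp_fderiv (k := fun A : E →L[ℝ] E ↦ A v) (by fun_prop) hS' X).trans (by
      rw [fderiv_clm_apply (by fun_prop) (by fun_prop)]; simp)
  rw [h2]
  simp [tangentCoord_coordVec hx, endCoord_apply]
  abel

end EndCoordinates

/-! ### The total space of `End(TM)` -/

section TotalSpaceEnd

variable [IsManifold 𝓘(ℝ, E) ∞ M]

/-- The model with corners of the total space of `End(TM)`. -/
abbrev endModel (E : Type*) [NormedAddCommGroup E] [NormedSpace ℝ E] :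
    ModelWithCorners ℝ (E × (E →L[ℝ] E)) (ModelProd E (E →L[ℝ] E)) :=
  𝓘(ℝ, E).prod 𝓘(ℝ, E →L[ℝ] E)

theorem mem_chartAt_end_source {Q w : EndBundle E M} :
    w ∈ (chartAt (ModelProd E (E →L[ℝ] E)) Q).source ↔ w.proj ∈ (chartAt E Q.proj).source := by
  rw [FiberBundle.chartedSpace_chartAt]
  simp only [mfld_simps]
  exact and_iff_left_of_imp id

theorem extChartAt_end_apply (Q w : EndBundle E M) :
    extChartAt (endModel E) Q w =
      (extChartAt 𝓘(ℝ, E) Q.proj w.proj, endCoord Q.proj w.proj w.snd) := by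
  rw [FiberBundle.extChartAt]
  rfl

theorem contMDiffAt_endCoord {p : M} {w : EndBundle E M} (hw : w.proj ∈ (chartAt E p).source) :
    ContMDiffAt (endModel E) 𝓘(ℝ, E →L[ℝ] E) ∞
      (fun w' : EndBundle E M ↦ endCoord p w'.proj w'.snd) w := by
  -- Any point over `p` would do: the chart of the total space depends only on the base point.
  set Q : EndBundle E M := ⟨p, 0⟩
  have h : ContMDiffAt (endModel E) 𝓘(ℝ, E × (E →L[ℝ] E)) ∞ (extChartAt (endModel E) Q) w :=
    contMDiffAt_extChartAt' (mem_chartAt_end_source.2 hw)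
  have h' := (contDiff_snd (n := ∞)).contMDiff.contMDiffAt.comp w h
  refine h'.congr_of_eventuallyEq (.of_eq ?_)
  funext w'
  simp only [Function.comp_apply, extChartAt_end_apply]
  rfl

/-- The differential of the fibre coordinate of `End(TM)` in the chart centred at `p`. -/
def fibreDeriv (p : M) (w : EndBundle E M) : TEnd w →L[ℝ] (E →L[ℝ] E) :=
  mvfderiv (endModel E) (fun w' : EndBundle E M ↦ endCoord p w'.proj w'.snd) w

theorem chartDeriv_end (Q : EndBundle E M) {w : EndBundle E M}
    (hw : w.proj ∈ (chartAt E Q.proj).source) (ξ : TEnd w) :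
    chartDeriv (endModel E) Q w ξ =
      (tangentCoord Q.proj w.proj (dproj w ξ), fibreDeriv Q.proj w ξ) := by
  have h1 := mdifferentiableAt_extChartAt (I := 𝓘(ℝ, E)) hw
  have hp := mdifferentiableAt_proj (IB := 𝓘(ℝ, E)) (EndT E M) (p := w)
  have h3 : MDifferentiableAt (endModel E) 𝓘(ℝ, E × (E →L[ℝ] E)) (extChartAt (endModel E) Q) w :=
    mdifferentiableAt_extChartAt (mem_chartAt_end_source.2 hw)
  have h4 : Prod.fst ∘ extChartAt (endModel E) Q =
      extChartAt 𝓘(ℝ, E) Q.proj ∘ (TotalSpace.proj : EndBundle E M → M) :=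
    funext fun w' ↦ congrArg Prod.fst (extChartAt_end_apply Q w')
  have h5 : Prod.snd ∘ extChartAt (endModel E) Q =
      fun w' : EndBundle E M ↦ endCoord Q.proj w'.proj w'.snd :=
    funext fun w' ↦ congrArg Prod.snd (extChartAt_end_apply Q w')
  have h6 := mfderiv_comp_apply w (I'' := 𝓘(ℝ, E)) differentiableAt_fst.mdifferentiableAt h3 ξ
  have h7 := mfderiv_comp_apply w (I'' := 𝓘(ℝ, E →L[ℝ] E))
    differentiableAt_snd.mdifferentiableAt h3 ξ
  rw [h4, mfderiv_comp_apply w h1 hp, mfderiv_eq_fderiv, fderiv_fst] at h6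
  rw [h5, mfderiv_eq_fderiv, fderiv_snd] at h7
  rw [tangentCoord_eq_mfderiv hw]
  exact Prod.ext h6.symm h7.symm

section

variable {E' : Type*} [NormedAddCommGroup E'] [NormedSpace ℝ E']
  {H : Type*} [TopologicalSpace H] {I : ModelWithCorners ℝ E' H} {N : Type*} [TopologicalSpace N]
  [ChartedSpace H N]

theorem fibreDeriv_mfderiv_comp {p : M} {f : N → EndBundle E M} {y : N} {Q : EndBundle E M}
    (hfy : f y = Q) (hp : Q.proj ∈ (chartAt E p).source)
    (hf : MDifferentiableAt I (endModel E) f y) (X : TangentSpace I y) :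
    fibreDeriv p Q ((mfderiv I (endModel E) f y : E' →L[ℝ] E × (E →L[ℝ] E)) X) =
      mvfderiv I (fun z ↦ endCoord p (f z).proj (f z).snd) y X := by
  subst hfy
  exact (mfderiv_comp_apply y ((contMDiffAt_endCoord hp).mdifferentiableAt (by simp)) hf X).symm

theorem dproj_mfderiv_comp {f : N → EndBundle E M} {y : N} {Q : EndBundle E M}
    (hfy : f y = Q) (hf : MDifferentiableAt I (endModel E) f y) (X : TangentSpace I y) :
    dproj Q ((mfderiv I (endModel E) f y : E' →L[ℝ] E × (E →L[ℝ] E)) X) =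
      (mfderiv I 𝓘(ℝ, E) (fun z ↦ (f z).proj) y : E' →L[ℝ] E) X := by
  subst hfy
  exact (mfderiv_comp_apply y (mdifferentiableAt_proj (EndT E M)) hf X).symm

end

theorem mdifferentiableAt_vertical_line (Q : EndBundle E M) (V : EndT E M Q.proj) :
    MDifferentiableAt 𝓘(ℝ, ℝ) (endModel E)
      (fun t : ℝ ↦ (⟨Q.proj, Q.snd + t • V⟩ : EndBundle E M)) 0 := by
  rw [mdifferentiableAt_totalSpace]
  refine ⟨mdifferentiableAt_const, ?_⟩
  simp only [trivializationAt_end_snd, map_add, map_smul]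
  apply DifferentiableAt.mdifferentiableAt
  fun_prop

theorem dproj_vLift (Q : EndBundle E M) (V : EndT E M Q.proj) : dproj Q (vLift Q V) = 0 := by
  refine (dproj_mfderiv_comp (Q := Q) (by simp) (mdifferentiableAt_vertical_line Q V) (1 : ℝ)).trans ?_
  rw [mfderiv_const]
  rfl

theorem fibreDeriv_vLift {p : M} {Q : EndBundle E M} (hQ : Q.proj ∈ (chartAt E p).source)
    (V : EndT E M Q.proj) : fibreDeriv p Q (vLift Q V) = endCoord p Q.proj V := by
  refine (fibreDeriv_mfderiv_comp (Q := Q) (by simp) hQ (mdifferentiableAt_vertical_line Q V)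
    (1 : ℝ)).trans ?_
  have h : HasDerivAt (fun t : ℝ ↦ endCoord p Q.proj (Q.snd + t • V)) (endCoord p Q.proj V) 0 := by
    simp only [map_add, map_smul]
    simpa using ((hasDerivAt_id (0 : ℝ)).smul_const (endCoord p Q.proj V)).const_add
      (endCoord p Q.proj Q.snd)
  have h' := h.hasFDerivAt.hasMFDerivAt.mfderiv
  exact congr($h' (1 : ℝ)).trans (one_smul ℝ _)

theorem mdifferentiableAt_extend_end (Q : EndBundle E M) :
    MDifferentiableAt 𝓘(ℝ, E) (endModel E)
      (fun x ↦ (⟨x, FiberBundle.extend (E →L[ℝ] E) Q.snd x⟩ : EndBundle E M)) Q.proj :=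
  FiberBundle.mdifferentiableAt_extend 𝓘(ℝ, E) (E →L[ℝ] E) Q.snd

variable [FiniteDimensional ℝ E]
  (cov : CovariantDerivative 𝓘(ℝ, E) E (TangentSpace 𝓘(ℝ, E) : M → Type _))

theorem dproj_hLift (Q : EndBundle E M) (X : TangentSpace 𝓘(ℝ, E) Q.proj) :
    dproj Q (hLift cov Q X) = X := by
  have h := dproj_mfderiv_comp (Q := Q) (by simp) (mdifferentiableAt_extend_end Q) X
  have hv := dproj_vLift Q (endCov cov (FiberBundle.extend (E →L[ℝ] E) Q.snd) Q.proj X)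
  refine (map_sub (mfderiv (endModel E) 𝓘(ℝ, E) (fun w : EndBundle E M ↦ w.proj) Q) _ _).trans ?_
  refine (congrArg₂ (· - ·) h hv).trans ?_
  rw [sub_zero]
  exact congr($(mfderiv_id (I := 𝓘(ℝ, E)) (x := Q.proj)) X)

/-- In `dS(X) - (∇_X S)^v` the coordinate derivative of `S` cancels against that in `∇ = d + [Γ,
·]`; only `-[Γ(X), P]` survives, whatever the section. -/
theorem fibreDeriv_hLift {p : M} {Q : EndBundle E M} (hQ : Q.proj ∈ (chartAt E p).source)
    (X : TangentSpace 𝓘(ℝ, E) Q.proj) :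
    fibreDeriv p Q (hLift cov Q X) =
      - (christoffel cov p Q.proj (tangentCoord p Q.proj X) ∘L endCoord p Q.proj Q.snd -
          endCoord p Q.proj Q.snd ∘L christoffel cov p Q.proj (tangentCoord p Q.proj X)) := by
  have hd := mdifferentiableAt_extend_end Q
  have h := fibreDeriv_mfderiv_comp (Q := Q) (by simp) hQ hd X
  have hv := fibreDeriv_vLift hQ (endCov cov (FiberBundle.extend (E →L[ℝ] E) Q.snd) Q.proj X)
  rw [endCoord_endCov cov hQ hd, FiberBundle.extend_apply_self] at hv
  refine (map_sub (fibreDeriv p Q) _ _).trans ?_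
  refine (congrArg₂ (· - ·) h hv).trans ?_
  simp

end TotalSpaceEnd

/-! ### The structure `𝒦` in coordinates -/

section ParaMapCoordinates

/-! ### The Nijenhuis expression of a field of endomorphisms of a vector space -/

section NijenhuisVectorSpace

variable {Z : Type*} [NormedAddCommGroup Z] [NormedSpace ℝ Z]

open VectorField in
/-- On a vector space, the Nijenhuis expression of a field of endomorphisms `K` with `K² = 1` at a
point depends there only on the values of the vector fields. -/
theorem nijenhuis_vectorSpace {K : Z → Z →L[ℝ] Z} {a b : Z → Z} {z : Z}
    (hK : DifferentiableAt ℝ K z) (ha : DifferentiableAt ℝ a z) (hb : DifferentiableAt ℝ b z)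
    (hK2 : ∀ v, K z (K z v) = v) :
    lieBracket ℝ a b z + lieBracket ℝ (fun y ↦ K y (a y)) (fun y ↦ K y (b y)) z
        - K z (lieBracket ℝ (fun y ↦ K y (a y)) b z)
        - K z (lieBracket ℝ a (fun y ↦ K y (b y)) z) =
      fderiv ℝ K z (K z (a z)) (b z) - fderiv ℝ K z (K z (b z)) (a z)
        + K z (fderiv ℝ K z (b z) (a z)) - K z (fderiv ℝ K z (a z) (b z)) := by
  simp only [lieBracket, fderiv_clm_apply hK ha, fderiv_clm_apply hK hb]
  -- The terms in `Db(Ka)` and `Da(Kb)` cancel in pairs, and those in `Db(a)` and `Da(b)` carry the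
  -- factor `1 - K²`. Hence `K² = 1` is needed at `z` only.
  simp [hK2]
  abel

end NijenhuisVectorSpace

/-! ### The structure on `E × End(E)` and its derivative -/

section ParaMap

/-- The commutator `a ↦ [G a, P]`. -/
def adMap (G : E →L[ℝ] E →L[ℝ] E) (P : E →L[ℝ] E) : E →L[ℝ] E →L[ℝ] E :=
  (ContinuousLinearMap.precomp E P - ContinuousLinearMap.postcomp E P) ∘L G

/-- The almost paracomplex structure `𝒦` in coordinates; `G` are the Christoffel symbols. -/
def paraMap (ε : ℝ) (G : E →L[ℝ] E →L[ℝ] E) (P : E →L[ℝ] E) :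
    E × (E →L[ℝ] E) →L[ℝ] E × (E →L[ℝ] E) :=
  (P ∘L ContinuousLinearMap.fst ℝ E (E →L[ℝ] E)).prod
    (-(adMap G P ∘L P ∘L ContinuousLinearMap.fst ℝ E (E →L[ℝ] E)) +
      ε • (ContinuousLinearMap.postcomp E P ∘L (ContinuousLinearMap.snd ℝ E (E →L[ℝ] E) +
        adMap G P ∘L ContinuousLinearMap.fst ℝ E (E →L[ℝ] E))))

theorem paraMap_apply (ε : ℝ) (G : E →L[ℝ] E →L[ℝ] E) (P : E →L[ℝ] E) (v : E × (E →L[ℝ] E)) :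
    paraMap ε G P v =
      (P v.1, -(G (P v.1) ∘L P - P ∘L G (P v.1)) + ε • (P ∘L (v.2 + (G v.1 ∘L P - P ∘L G v.1)))) :=
  rfl

/-- In terms of the base part `x` and the vertical part `V = A + [G x, P]`, the map is `(x, V) ↦ (P
x, ε P V)`, whose square is the identity. -/
theorem paraMap_paraMap {ε : ℝ} (hε : ε * ε = 1) (G : E →L[ℝ] E →L[ℝ] E) {P : E →L[ℝ] E}
    (hP : ∀ v, P (P v) = v) (v : E × (E →L[ℝ] E)) :
    paraMap ε G P (paraMap ε G P v) = v := by
  simp only [paraMap_apply, hP]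
  refine Prod.ext rfl ?_
  ext u
  simp [hP, smul_smul, hε]
  module

variable {γ : E → E →L[ℝ] E →L[ℝ] E}

/-- In finite dimension an operator-valued map is a fixed linear expression in its values on a
basis. This lets `paraMap` be differentiated after evaluation at a fixed vector. -/
theorem differentiableAt_clm_of_apply {D Z W : Type*} [NormedAddCommGroup D] [NormedSpace ℝ D]
    [NormedAddCommGroup Z] [NormedSpace ℝ Z] [FiniteDimensional ℝ Z] [NormedAddCommGroup W]
    [NormedSpace ℝ W] {K : D → Z →L[ℝ] W} {x : D}
    (h : ∀ v, DifferentiableAt ℝ (fun z ↦ K z v) x) : DifferentiableAt ℝ K x := by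
  set b := Module.finBasis ℝ Z
  have h1 : K = fun z ↦ ∑ j, ContinuousLinearMap.smulRightL ℝ Z W
      (LinearMap.toContinuousLinearMap (b.coord j)) (K z (b j)) := by
    funext z
    ext v
    conv_lhs => rw [← b.sum_repr v, map_sum]
    simp [-Module.Basis.sum_repr]
  rw [h1]
  exact DifferentiableAt.fun_sum fun j _ ↦ (ContinuousLinearMap.differentiableAt _).comp x (h (b j))

theorem fderiv_apply_eq_of_hasDerivAt {D Z W : Type*} [NormedAddCommGroup D] [NormedSpace ℝ D]
    [NormedAddCommGroup Z] [NormedSpace ℝ Z] [NormedAddCommGroup W] [NormedSpace ℝ W]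
    {K : D → Z →L[ℝ] W} {x c : D} {v : Z} {w : W} (hK : DifferentiableAt ℝ K x)
    (h : HasDerivAt (fun t : ℝ ↦ K (x + t • c) v) w 0) : fderiv ℝ K x c v = w := by
  have hline : HasDerivAt (fun t : ℝ ↦ x + t • c) c 0 := by
    simpa using ((hasDerivAt_id (0 : ℝ)).smul_const c).const_add x
  have hK' : HasFDerivAt (fun y ↦ K y v) ((fderiv ℝ K x).flip v) (x + (0 : ℝ) • c) := by
    rw [zero_smul, add_zero]
    simpa using hK.hasFDerivAt.clm_apply (hasFDerivAt_const v x)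
  have h' : HasDerivAt (fun t : ℝ ↦ K (x + t • c) v) ((fderiv ℝ K x).flip v c) 0 :=
    HasFDerivAt.comp_hasDerivAt (l := fun y ↦ K y v) (0 : ℝ) hK' hline
  exact h'.unique h

theorem hasDerivAt_paraMap {G : ℝ → E →L[ℝ] E →L[ℝ] E} {P : ℝ → E →L[ℝ] E}
    {G' : E →L[ℝ] E →L[ℝ] E} {P' : E →L[ℝ] E} {t : ℝ} (ε : ℝ) (hG : HasDerivAt G G' t)
    (hP : HasDerivAt P P' t) (v : E × (E →L[ℝ] E)) :
    HasDerivAt (fun s ↦ paraMap ε (G s) (P s) v)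
      (P' v.1,
        -((G' (P t v.1) + G t (P' v.1)) ∘L P t + G t (P t v.1) ∘L P'
            - (P' ∘L G t (P t v.1) + P t ∘L (G' (P t v.1) + G t (P' v.1))))
          + ε • (P' ∘L (v.2 + (G t v.1 ∘L P t - P t ∘L G t v.1))
            + P t ∘L (G' v.1 ∘L P t + G t v.1 ∘L P' - (P' ∘L G t v.1 + P t ∘L G' v.1)))) t := by
  have hPv : HasDerivAt (fun s ↦ P s v.1) (P' v.1) t := by
    simpa using hP.clm_apply (hasDerivAt_const t v.1)
  have hGv : HasDerivAt (fun s ↦ G s v.1) (G' v.1) t := by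
    simpa using hG.clm_apply (hasDerivAt_const t v.1)
  have hGPv := hG.clm_apply hPv
  have h1 := ((hGPv.clm_comp hP).sub (hP.clm_comp hGPv)).neg
  have h2 := (hP.clm_comp (((hGv.clm_comp hP).sub (hP.clm_comp hGv)).const_add v.2)).const_smul ε
  exact hPv.prodMk (h1.add h2)

variable {γ : E → E →L[ℝ] E →L[ℝ] E}

theorem differentiableAt_paraMap [FiniteDimensional ℝ E] (ε : ℝ) {z : E × (E →L[ℝ] E)}
    (hγ : DifferentiableAt ℝ γ z.1) :
    DifferentiableAt ℝ (fun z : E × (E →L[ℝ] E) ↦ paraMap ε (γ z.1) z.2) z := by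
  refine differentiableAt_clm_of_apply fun v ↦ ?_
  have hG : DifferentiableAt ℝ (fun z : E × (E →L[ℝ] E) ↦ γ z.1) z :=
    DifferentiableAt.comp (𝕜 := ℝ) (E := E × (E →L[ℝ] E)) (F := E)
      (G := E →L[ℝ] E →L[ℝ] E) (g := γ) (f := Prod.fst) z hγ differentiableAt_fst
  have hP : DifferentiableAt ℝ (fun z : E × (E →L[ℝ] E) ↦ z.2) z := differentiableAt_snd
  have hPv := hP.clm_apply (differentiableAt_const v.1)
  have hGv := hG.clm_apply (differentiableAt_const v.1)
  have hGPv := hG.clm_apply hPv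
  have h1 := ((hGPv.clm_comp hP).sub (hP.clm_comp hGPv)).neg
  have h2 := (hP.clm_comp (((hGv.clm_comp hP).sub (hP.clm_comp hGv)).const_add v.2)).const_smul ε
  exact hPv.prodMk (h1.add h2)

theorem fderiv_paraMap [FiniteDimensional ℝ E] (ε : ℝ) {z : E × (E →L[ℝ] E)}
    (hγ : DifferentiableAt ℝ γ z.1) (c v : E × (E →L[ℝ] E)) :
    fderiv ℝ (fun z : E × (E →L[ℝ] E) ↦ paraMap ε (γ z.1) z.2) z c v =
      (c.2 v.1,
        -((fderiv ℝ γ z.1 c.1 (z.2 v.1) + γ z.1 (c.2 v.1)) ∘L z.2 + γ z.1 (z.2 v.1) ∘L c.2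
            - (c.2 ∘L γ z.1 (z.2 v.1)
              + z.2 ∘L (fderiv ℝ γ z.1 c.1 (z.2 v.1) + γ z.1 (c.2 v.1))))
          + ε • (c.2 ∘L (v.2 + (γ z.1 v.1 ∘L z.2 - z.2 ∘L γ z.1 v.1))
            + z.2 ∘L (fderiv ℝ γ z.1 c.1 v.1 ∘L z.2 + γ z.1 v.1 ∘L c.2 - (c.2 ∘L γ z.1 v.1
              + z.2 ∘L fderiv ℝ γ z.1 c.1 v.1)))) := by
  have hline : HasDerivAt (fun t : ℝ ↦ z + t • c) c 0 := by
    simpa using ((hasDerivAt_id (0 : ℝ)).smul_const c).const_add z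
  have hz : z + (0 : ℝ) • c = z := by simp
  have hG : HasDerivAt (fun t : ℝ ↦ γ (z + t • c).1) (fderiv ℝ γ z.1 c.1) 0 := by
    refine HasFDerivAt.comp_hasDerivAt (F := E) (E := E →L[ℝ] E →L[ℝ] E) (l := γ)
      (f := fun t : ℝ ↦ (z + t • c).1) 0 ?_ hline.fst
    simpa using hγ.hasFDerivAt
  refine fderiv_apply_eq_of_hasDerivAt (differentiableAt_paraMap ε hγ) ?_
  simpa only [hz] using hasDerivAt_paraMap ε hG hline.snd v

end ParaMap

end ParaMapCoordinates

/-! ### The Nijenhuis expression in a chart -/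

section NijenhuisChart

section
variable {E' : Type*} [NormedAddCommGroup E'] [NormedSpace ℝ E']
  {H : Type*} [TopologicalSpace H] {I : ModelWithCorners ℝ E' H} {N : Type*} [TopologicalSpace N]
  [ChartedSpace H N]

theorem chartDeriv_add (x y : N) (ξ η : TangentSpace I y) :
    chartDeriv I x y (ξ + η) = chartDeriv I x y ξ + chartDeriv I x y η := map_add _ _ _

theorem chartDeriv_zero (x y : N) : chartDeriv I x y 0 = 0 := map_zero _

theorem chartDeriv_sub (x y : N) (ξ η : TangentSpace I y) :
    chartDeriv I x y (ξ - η) = chartDeriv I x y ξ - chartDeriv I x y η := map_sub _ _ _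

theorem chartDeriv_smul (x y : N) (c : ℝ) (ξ : TangentSpace I y) :
    chartDeriv I x y (c • ξ) = c • chartDeriv I x y ξ := map_smul _ _ _

end

variable [IsManifold 𝓘(ℝ, E) ∞ M]

theorem endCoord_comp {p x : M} (hx : x ∈ (chartAt E p).source) (A B : EndT E M x) :
    endCoord p x (A ∘L B) = endCoord p x A ∘L endCoord p x B := by
  ext v
  simp [endCoord_apply, coordVec_tangentCoord hx]

theorem endCoord_surjective {p x : M} (hx : x ∈ (chartAt E p).source) :
    Function.Surjective (endCoord p x : EndT E M x → (E →L[ℝ] E)) := fun B ↦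
  ⟨coordVec p x ∘L B ∘L tangentCoord p x, by
    ext v
    simp [endCoord_apply, tangentCoord_coordVec hx]⟩

theorem dproj_add (w : EndBundle E M) (ξ η : TEnd w) : dproj w (ξ + η) = dproj w ξ + dproj w η :=
  map_add (mfderiv (endModel E) 𝓘(ℝ, E) (fun w : EndBundle E M ↦ w.proj) w) _ _

theorem chartDeriv_vLift (Q : EndBundle E M) {w : EndBundle E M}
    (hw : w.proj ∈ (chartAt E Q.proj).source) (V : EndT E M w.proj) :
    chartDeriv (endModel E) Q w (vLift w V) = (0, endCoord Q.proj w.proj V) := by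
  rw [chartDeriv_end Q hw, dproj_vLift, map_zero, fibreDeriv_vLift hw]

variable [FiniteDimensional ℝ E]
  (cov : CovariantDerivative 𝓘(ℝ, E) E (TangentSpace 𝓘(ℝ, E) : M → Type _))

theorem chartDeriv_hLift (Q : EndBundle E M) {w : EndBundle E M}
    (hw : w.proj ∈ (chartAt E Q.proj).source) (X : TangentSpace 𝓘(ℝ, E) w.proj) :
    chartDeriv (endModel E) Q w (hLift cov w X) = (tangentCoord Q.proj w.proj X,
      -(christoffel cov Q.proj w.proj (tangentCoord Q.proj w.proj X) ∘L
            endCoord Q.proj w.proj w.snd -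
          endCoord Q.proj w.proj w.snd ∘L
            christoffel cov Q.proj w.proj (tangentCoord Q.proj w.proj X))) := by
  rw [chartDeriv_end Q hw, dproj_hLift, fibreDeriv_hLift cov hw]

/-- Subtracting the horizontal lift of the projection leaves a vector with zero base component,
which is vertical. Identities for `paraK` thus need checking only on sums of lifts. -/
theorem exists_eq_hLift_add_vLift (w : EndBundle E M) (ξ : TEnd w) :
    ∃ V, ξ = hLift cov w (dproj w ξ) + vLift w V := by
  have hw := mem_chart_source E w.proj
  obtain ⟨V, hV⟩ := endCoord_surjective hw (fibreDeriv w.proj w ξ -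
    fibreDeriv w.proj w (hLift cov w (dproj w ξ)))
  refine ⟨V, chartDeriv_injective (I := endModel E) (mem_extChartAt_source w) ?_⟩
  rw [chartDeriv_add, chartDeriv_vLift w hw, chartDeriv_end w hw, chartDeriv_end w hw, dproj_hLift, hV]
  ext <;> simp

theorem vertComp_hLift_add_vLift (w : EndBundle E M) (X : TangentSpace 𝓘(ℝ, E) w.proj)
    (V : EndT E M w.proj) : vertComp (endCov cov) w (hLift cov w X + vLift w V) = V := by
  have hw := mem_chart_source E w.proj
  have h1 : hLift cov w X + vLift w V - horLift (endCov cov) w (dproj w (hLift cov w X + vLift w V))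
      = vLift w V := by
    rw [dproj_add, dproj_hLift, dproj_vLift, add_zero]
    exact add_sub_cancel_left _ _
  rw [vertComp, h1]
  refine (congrArg ((trivializationAt (E →L[ℝ] E) (EndT E M) w.proj).symm w.proj)
    (fibreDeriv_vLift hw V)).trans ?_
  exact Trivialization.symm_apply_apply_mk _ (mem_baseSet_hom_iff.2 hw) V

theorem paraK_hLift_add_vLift (i : ℕ) (w : EndBundle E M) (X : TangentSpace 𝓘(ℝ, E) w.proj)
    (V : EndT E M w.proj) :
    paraK cov i w (hLift cov w X + vLift w V) =
      hLift cov w (w.snd X) + vLift w ((-1 : ℝ) ^ (i + 1) • (w.snd ∘L V)) := by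
  rw [paraK, vertComp_hLift_add_vLift, dproj_add, dproj_hLift, dproj_vLift, add_zero]

/-- `𝒦` in the chart of `End(TM)` at `Q`. -/
theorem chartDeriv_paraK (i : ℕ) (Q : EndBundle E M) {w : EndBundle E M}
    (hw : w.proj ∈ (chartAt E Q.proj).source) (ξ : TEnd w) :
    chartDeriv (endModel E) Q w (paraK cov i w ξ) =
      paraMap ((-1) ^ (i + 1)) (christoffel cov Q.proj w.proj) (endCoord Q.proj w.proj w.snd)
        (chartDeriv (endModel E) Q w ξ) := by
  obtain ⟨V, hV⟩ := exists_eq_hLift_add_vLift cov w ξ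
  rw [hV, paraK_hLift_add_vLift]
  simp only [chartDeriv_add, chartDeriv_hLift cov Q hw, chartDeriv_vLift Q hw, paraMap_apply, map_smul,
    endCoord_comp hw, Prod.mk_add_mk, add_zero, endCoord_tangentCoord hw]
  simp
  module

section Nijenhuis

variable [T2Space M]

/-- This carries `nijenhuis_vectorSpace` to `End(TM)`. The fields need only be smooth near `Q`;
tangency to `𝒵` plays no role in the value, because `Q² = 1` at the single point `Q` suffices. -/
theorem chartDeriv_nijenhuis (hcov : CovariantDerivative.ContMDiffCovariantDerivative cov ∞)
    (i : ℕ) {Q : EndBundle E M} (hQ : ∀ X, Q.snd (Q.snd X) = X) {A B : ∀ w : EndBundle E M, TEnd w}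
    (hA : ContMDiffAt (endModel E) ((endModel E).prod 𝓘(ℝ, E × (E →L[ℝ] E))) ∞
      (fun w ↦ (⟨w, A w⟩ : TangentBundle (endModel E) (EndBundle E M))) Q)
    (hB : ContMDiffAt (endModel E) ((endModel E).prod 𝓘(ℝ, E × (E →L[ℝ] E))) ∞
      (fun w ↦ (⟨w, B w⟩ : TangentBundle (endModel E) (EndBundle E M))) Q)
    {a b z : E × (E →L[ℝ] E)}
    (ha : chartDeriv (endModel E) Q Q (A Q) = a) (hb : chartDeriv (endModel E) Q Q (B Q) = b)
    (hz : extChartAt (endModel E) Q Q = z)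
    {γ : E → E →L[ℝ] E →L[ℝ] E}
    (hγ : γ = fun y ↦ christoffel cov Q.proj ((extChartAt 𝓘(ℝ, E) Q.proj).symm y))
    {K : E × (E →L[ℝ] E) → E × (E →L[ℝ] E) →L[ℝ] E × (E →L[ℝ] E)}
    (hK : K = fun z ↦ paraMap ((-1) ^ (i + 1)) (γ z.1) z.2) :
    DifferentiableAt ℝ γ z.1 ∧ chartDeriv (endModel E) Q Q (nijenhuis cov i A B Q) =
      fderiv ℝ K z (K z a) b - fderiv ℝ K z (K z b) a
        + K z (fderiv ℝ K z b a) - K z (fderiv ℝ K z a b) := by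
  have hp := mem_chart_source E Q.proj
  have hz1 : z.1 = extChartAt 𝓘(ℝ, E) Q.proj Q.proj := by rw [← hz, extChartAt_end_apply]
  have hz2 : z.2 = endCoord Q.proj Q.proj Q.snd := by rw [← hz, extChartAt_end_apply]
  have hγz : γ z.1 = christoffel cov Q.proj Q.proj := by
    rw [hγ, hz1]
    simp
  have hγd : DifferentiableAt ℝ γ z.1 := by
    rw [hγ, hz1]
    have h1 := contMDiffAt_christoffel cov hcov hp
    have hs : ContMDiffAt 𝓘(ℝ, E) 𝓘(ℝ, E) ∞ (extChartAt 𝓘(ℝ, E) Q.proj).symm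
        (extChartAt 𝓘(ℝ, E) Q.proj Q.proj) :=
      (contMDiffOn_extChartAt_symm Q.proj).contMDiffAt
        ((isOpen_extChartAt_target Q.proj).mem_nhds (mem_extChartAt_target Q.proj))
    exact (h1.comp_of_eq hs (extChartAt_to_inv Q.proj)).contDiffAt.differentiableAt (by simp)
  have hKd : DifferentiableAt ℝ K z := hK ▸ differentiableAt_paraMap _ hγd
  have hKz : ∀ ξ : TEnd Q, chartDeriv (endModel E) Q Q (paraK cov i Q ξ) =
      K z (chartDeriv (endModel E) Q Q ξ) := by
    intro ξ
    rw [chartDeriv_paraK cov i Q hp, hK, ← hγz, ← hz2]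
  have hKK : ∀ v, K z (K z v) = v := by
    rw [hK]
    refine paraMap_paraMap ?_ _ ?_
    · rw [← mul_pow]
      simp
    · intro v
      simp [hz2, endCoord_apply, coordVec_tangentCoord hp, hQ, tangentCoord_coordVec hp]
  -- Brackets depend on germs, so `𝒦` has to be identified with `K` on a whole neighbourhood,
  -- including points outside `𝒵`.
  have hfield : ∀ C : (∀ w : EndBundle E M, TEnd w),
      fieldInChart (endModel E) Q (fun w ↦ paraK cov i w (C w)) =ᶠ[𝓝 z]
        fun y ↦ K y (fieldInChart (endModel E) Q C y) := by
    intro C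
    rw [← hz]
    filter_upwards [(isOpen_extChartAt_target Q).mem_nhds (mem_extChartAt_target Q)] with y hy
    have h1 := (extChartAt (endModel E) Q).map_target hy
    have h2 := (extChartAt (endModel E) Q).right_inv hy
    rw [extChartAt_source, mem_chartAt_end_source] at h1
    rw [extChartAt_end_apply] at h2
    rw [fieldInChart, chartDeriv_paraK cov i Q h1, fieldInChart, hK, hγ]
    beta_reduce
    rw [← congrArg Prod.fst h2, ← congrArg Prod.snd h2]
    simp only
    rw [(extChartAt 𝓘(ℝ, E) Q.proj).left_inv (by rwa [extChartAt_source])]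

  have hAa : fieldInChart (endModel E) Q A z = a := by
    rw [← hz, ← ha, fieldInChart, extChartAt_to_inv]
  have hBb : fieldInChart (endModel E) Q B z = b := by
    rw [← hz, ← hb, fieldInChart, extChartAt_to_inv]
  have hAd := differentiableAt_fieldInChart hA
  have hBd := differentiableAt_fieldInChart hB
  rw [hz] at hAd hBd
  refine ⟨hγd, ?_⟩
  rw [← hAa, ← hBb, ← nijenhuis_vectorSpace hKd hAd hBd hKK]
  simp only [nijenhuis, bracket, chartDeriv_sub, chartDeriv_add, hKz, chartDeriv_mlieBracket, hz]
  rw [(hfield A).lieBracket_vectorField_eq (hfield B),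
    (hfield A).lieBracket_vectorField_eq (Filter.EventuallyEq.refl _ _),
    (Filter.EventuallyEq.refl _ _).lieBracket_vectorField_eq (hfield B)]

end Nijenhuis

end NijenhuisChart

/-! ### The curvature of the induced connection in coordinates -/

section CurvatureCoordinates

variable [IsManifold 𝓘(ℝ, E) ∞ M]

theorem extend_tangent {p y : M} (hy : y ∈ (chartAt E p).source) (X : TangentSpace 𝓘(ℝ, E) p) :
    FiberBundle.extend E X y = coordVec p y (tangentCoord p p X) := by
  rw [FiberBundle.extend, trivializationAt_snd (mem_chart_source E p)]
  exact (Trivialization.symmL_apply _ hy _).symm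

/-- The standard extension of a tangent vector has constant coordinates near `p`, so the `∇_{[X,Y]}`
term of the curvature vanishes. -/
theorem mlieBracket_extend [FiniteDimensional ℝ E] (p : M) (X Y : TangentSpace 𝓘(ℝ, E) p) :
    VectorField.mlieBracket 𝓘(ℝ, E) (FiberBundle.extend E X) (FiberBundle.extend E Y) p = 0 := by
  have h : ∀ Z : TangentSpace 𝓘(ℝ, E) p, (FiberBundle.extend E Z : ∀ y : M, TangentSpace 𝓘(ℝ, E) y)
      =ᶠ[𝓝 p] fun y ↦ coordVec p y (tangentCoord p p Z) := by
    intro Z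
    filter_upwards [(chartAt E p).open_source.mem_nhds (mem_chart_source E p)] with y hy
      using extend_tangent hy Z
  rw [(h X).mlieBracket_vectorField_eq (h Y), mlieBracket_coordVec]

theorem endCoord_extend {p y : M} (hy : y ∈ (chartAt E p).source) (s : EndT E M p) :
    endCoord p y (FiberBundle.extend (E →L[ℝ] E) s y) = endCoord p p s := by
  rw [← trivializationAt_end_snd, FiberBundle.extend, trivializationAt_end_snd p p]
  exact congrArg Prod.snd (Trivialization.apply_mk_symm _ (mem_baseSet_hom_iff.2 hy) _)

variable [FiniteDimensional ℝ E]
  (cov : CovariantDerivative 𝓘(ℝ, E) E (TangentSpace 𝓘(ℝ, E) : M → Type _))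

set_option synthInstance.maxHeartbeats 200000 in
theorem mvfderiv_christoffel {p : M} (X : TangentSpace 𝓘(ℝ, E) p)
    {γ : E → E →L[ℝ] E →L[ℝ] E}
    (hγ : γ = fun y ↦ christoffel cov p ((extChartAt 𝓘(ℝ, E) p).symm y))
    (hγd : DifferentiableAt ℝ γ (extChartAt 𝓘(ℝ, E) p p)) :
    mvfderiv 𝓘(ℝ, E) (christoffel cov p) p X =
      fderiv ℝ γ (extChartAt 𝓘(ℝ, E) p p) (tangentCoord p p X) := by
  have hp := mem_chart_source E p
  have h1 : christoffel cov p =ᶠ[𝓝 p] fun y ↦ γ (extChartAt 𝓘(ℝ, E) p y) := by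
    filter_upwards [(chartAt E p).open_source.mem_nhds hp] with y hy
    rw [hγ]
    simp only
    rw [(extChartAt 𝓘(ℝ, E) p).left_inv (by rwa [extChartAt_source])]
  rw [mvfderiv_congr h1, mvfderiv_comp_fderiv (F := E) (G := E →L[ℝ] E →L[ℝ] E) (k := γ) hγd (mdifferentiableAt_extChartAt hp),
    tangentCoord_eq_mfderiv hp]
  rfl

variable [T2Space M]

set_option synthInstance.maxHeartbeats 200000 in
/-- The second covariant derivative of a section of `End(TM)` that is constant in coordinates,
along constant fields. -/
theorem endCoord_endCov_endCov_extend
    (hcov : CovariantDerivative.ContMDiffCovariantDerivative cov ∞)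
    {p : M} (X Y : TangentSpace 𝓘(ℝ, E) p) (s : EndT E M p)
    {G T : E →L[ℝ] E →L[ℝ] E} {P : E →L[ℝ] E} {a b : E} (ha : tangentCoord p p X = a)
    (hb : tangentCoord p p Y = b) (hP : endCoord p p s = P) (hG : christoffel cov p p = G)
    (hT : mvfderiv 𝓘(ℝ, E) (christoffel cov p) p X = T) :
    endCoord p p (endCov cov (fun x ↦ endCov cov (FiberBundle.extend (E →L[ℝ] E) s) x
        (FiberBundle.extend E Y x)) p X) =
      (T b ∘L P - P ∘L T b) + (G a ∘L (G b ∘L P - P ∘L G b) - (G b ∘L P - P ∘L G b) ∘L G a) := by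
  have hp := mem_chart_source E p
  -- The first covariant derivative is `[Γ(b), P]` with `b` and `P` constant. It is a fixed linear
  -- function `k` of `Γ`, so its derivative is `k` applied to that of `Γ`.
  set k : (E →L[ℝ] E →L[ℝ] E) →L[ℝ] (E →L[ℝ] E) :=
    (ContinuousLinearMap.precomp E P - ContinuousLinearMap.postcomp E P) ∘L
      ContinuousLinearMap.apply ℝ (E →L[ℝ] E) b
  have hk : ∀ C, k C = C b ∘L P - P ∘L C b := fun C ↦ rfl
  have hex : ∀ x ∈ (chartAt E p).source, MDifferentiableAt 𝓘(ℝ, E) (endModel E)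
      (fun y ↦ (⟨y, FiberBundle.extend (E →L[ℝ] E) s y⟩ : EndBundle E M)) x := by
    intro x hx
    rw [mdifferentiableAt_end_iff hx]
    refine (mdifferentiableAt_const (c := P)).congr_of_eventuallyEq ?_
    filter_upwards [(chartAt E p).open_source.mem_nhds hx] with y hy
    rw [endCoord_extend hy, hP]
  have hS : ∀ x ∈ (chartAt E p).source,
      endCoord p x (endCov cov (FiberBundle.extend (E →L[ℝ] E) s) x (FiberBundle.extend E Y x)) =
        k (christoffel cov p x) := by
    intro x hx
    have h0 : mvfderiv 𝓘(ℝ, E) (fun y ↦ endCoord p y (FiberBundle.extend (E →L[ℝ] E) s y)) x = 0 := by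
      rw [← mvfderiv_const P (I := 𝓘(ℝ, E))]
      apply mvfderiv_congr
      filter_upwards [(chartAt E p).open_source.mem_nhds hx] with y hy
      rw [endCoord_extend hy, hP]
    rw [endCoord_endCov cov hx (hex x hx), h0, hk, endCoord_extend hx, hP, extend_tangent hx,
      tangentCoord_coordVec hx, hb, zero_apply, zero_add]
  have hS' : (fun x ↦ endCoord p x
      (endCov cov (FiberBundle.extend (E →L[ℝ] E) s) x (FiberBundle.extend E Y x))) =ᶠ[𝓝 p]
        fun x ↦ k (christoffel cov p x) := by
    filter_upwards [(chartAt E p).open_source.mem_nhds hp] with y hy using hS y hy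
  have hc : MDifferentiableAt 𝓘(ℝ, E) 𝓘(ℝ, E →L[ℝ] E →L[ℝ] E) (christoffel cov p) p :=
    (contMDiffAt_christoffel cov hcov hp).mdifferentiableAt (by simp)
  have hd : MDifferentiableAt 𝓘(ℝ, E) 𝓘(ℝ, E →L[ℝ] E) (fun x ↦ k (christoffel cov p x)) p :=
    (ContinuousLinearMap.differentiableAt (E := E →L[ℝ] E →L[ℝ] E) k).mdifferentiableAt.comp p hc
  rw [endCoord_endCov cov hp ((mdifferentiableAt_end_iff hp).2 (hd.congr_of_eventuallyEq hS')),
    mvfderiv_congr hS', mvfderiv_comp_fderiv (F := E →L[ℝ] E →L[ℝ] E) (k := k) k.differentiableAt hc, hS p hp, k.fderiv, hT, hk, hk,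
    ha, hG]

/-- With a vanishing bracket, the sign convention leaves `∇_Y ∇_X - ∇_X ∇_Y`, whence the order of
the two blocks. -/
theorem endCoord_curvature
    (hcov : CovariantDerivative.ContMDiffCovariantDerivative cov ∞)
    {p : M} (X Y : TangentSpace 𝓘(ℝ, E) p) (s : EndT E M p)
    {γ : E → E →L[ℝ] E →L[ℝ] E}
    (hγ : γ = fun y ↦ christoffel cov p ((extChartAt 𝓘(ℝ, E) p).symm y))
    {z : E} (hz : extChartAt 𝓘(ℝ, E) p p = z) (hγd : DifferentiableAt ℝ γ z)
    {P : E →L[ℝ] E} {a b : E} (ha : tangentCoord p p X = a)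
    (hb : tangentCoord p p Y = b) (hP : endCoord p p s = P) :
    endCoord p p (curvature (endCov cov) X Y s) =
      (fderiv ℝ γ z b a ∘L P - P ∘L fderiv ℝ γ z b a)
        + (γ z b ∘L (γ z a ∘L P - P ∘L γ z a) - (γ z a ∘L P - P ∘L γ z a) ∘L γ z b)
        - ((fderiv ℝ γ z a b ∘L P - P ∘L fderiv ℝ γ z a b)
        + (γ z a ∘L (γ z b ∘L P - P ∘L γ z b) - (γ z b ∘L P - P ∘L γ z b) ∘L γ z a)) := by
  subst hz
  have hγz : christoffel cov p p = γ (extChartAt 𝓘(ℝ, E) p p) := by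
    rw [hγ]
    simp
  have hX := mvfderiv_christoffel cov X hγ hγd
  have hY := mvfderiv_christoffel cov Y hγ hγd
  rw [curvature, map_sub, map_sub, endCoord_endCov_endCov_extend cov hcov X Y s ha hb hP hγz hX,
    endCoord_endCov_endCov_extend cov hcov Y X s hb ha hP hγz hY, mlieBracket_extend, ha, hb]
  simp only [map_zero, zero_sub, neg_sub]

end CurvatureCoordinates

/-! ### The Nijenhuis expression: linear algebra -/

section NijenhuisAlgebra

section Algebra

/-- The derivative of `paraMap` in the direction `c`, applied to `v`. -/
def paraMapDeriv (ε : ℝ) (G : E →L[ℝ] E →L[ℝ] E) (T : E → E →L[ℝ] E →L[ℝ] E) (P : E →L[ℝ] E)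
    (c v : E × (E →L[ℝ] E)) : E × (E →L[ℝ] E) :=
  (c.2 v.1,
    -((T c.1 (P v.1) + G (c.2 v.1)) ∘L P + G (P v.1) ∘L c.2
        - (c.2 ∘L G (P v.1) + P ∘L (T c.1 (P v.1) + G (c.2 v.1))))
      + ε • (c.2 ∘L (v.2 + (G v.1 ∘L P - P ∘L G v.1))
        + P ∘L (T c.1 v.1 ∘L P + G v.1 ∘L c.2 - (c.2 ∘L G v.1 + P ∘L T c.1 v.1))))

/-- The Nijenhuis expression of `paraMap`. -/
def paraMapNijenhuis (ε : ℝ) (G : E →L[ℝ] E →L[ℝ] E) (T : E → E →L[ℝ] E →L[ℝ] E) (P : E →L[ℝ] E)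
    (a b : E × (E →L[ℝ] E)) : E × (E →L[ℝ] E) :=
  paraMapDeriv ε G T P (paraMap ε G P a) b - paraMapDeriv ε G T P (paraMap ε G P b) a
    + paraMap ε G P (paraMapDeriv ε G T P b a) - paraMap ε G P (paraMapDeriv ε G T P a b)

/-- The curvature of `d + [Γ, ·]` with `Γ = G` and `dΓ = T` at a point. -/
def endCurv (G : E →L[ℝ] E →L[ℝ] E) (T : E → E →L[ℝ] E →L[ℝ] E) (P : E →L[ℝ] E) (a b : E) :
    E →L[ℝ] E :=
  (T b a ∘L P - P ∘L T b a) + (G b ∘L (G a ∘L P - P ∘L G a) - (G a ∘L P - P ∘L G a) ∘L G b)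
    - ((T a b ∘L P - P ∘L T a b) + (G a ∘L (G b ∘L P - P ∘L G b) - (G b ∘L P - P ∘L G b) ∘L G a))

variable {ε : ℝ} {G : E →L[ℝ] E →L[ℝ] E} {T : E → E →L[ℝ] E →L[ℝ] E} {P : E →L[ℝ] E}

/-- On vertical vectors `K` is left multiplication by `εP`, and the products `PAB` and `PBA` each
occur twice with opposite signs. Since `T` is a bare function here, `T 0 = 0` is what remains of its
linearity. -/
theorem paraMapNijenhuis_vertical (hε : ε = 1 ∨ ε = -1) (hT : T 0 = 0)
    (A B : E →L[ℝ] E) :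
    paraMapNijenhuis ε G T P (0, A) (0, B) = 0 := by
  refine Prod.ext ?_ ?_
  · simp [paraMapNijenhuis, paraMapDeriv, paraMap_apply]
  · ext u
    rcases hε with rfl | rfl <;> simp [paraMapNijenhuis, paraMapDeriv, paraMap_apply, hT]

/-- In the base component `-dK(Kb) a` contributes `-ε P B x` and `K(dK(b) a)` contributes `P B x`.
The fibre component is exactly the correction that makes the result horizontal. -/
theorem paraMapNijenhuis_mixed (hε : ε = 1 ∨ ε = -1) (hP : ∀ v, P (P v) = v) (hT : T 0 = 0)
    (x : E) (B : E →L[ℝ] E) :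
    paraMapNijenhuis ε G T P (x, -(G x ∘L P - P ∘L G x)) (0, B) =
      (1 - ε) • (P (B x), -(G (P (B x)) ∘L P - P ∘L G (P (B x)))) := by
  refine Prod.ext ?_ ?_
  · rcases hε with rfl | rfl <;> simp [paraMapNijenhuis, paraMapDeriv, paraMap_apply, hT]
    module
  · ext u
    rcases hε with rfl | rfl <;> 
      simp [paraMapNijenhuis, paraMapDeriv, paraMap_apply, hP, hT] <;> module

/-- The base component is a sum of values of `G` on pairs from `x, Px` and `y, Py`, cancelling by
symmetry and `P² = 1`. In the fibre component the `T` terms and double commutators group into the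
four curvatures. -/
theorem paraMapNijenhuis_horizontal (hε : ε = 1 ∨ ε = -1) (hP : ∀ v, P (P v) = v)
    (hG : ∀ u v, G u v = G v u) (x y : E) :
    paraMapNijenhuis ε G T P (x, -(G x ∘L P - P ∘L G x)) (y, -(G y ∘L P - P ∘L G y)) =
      (0, endCurv G T P x y + endCurv G T P (P x) (P y) - ε • (P ∘L endCurv G T P (P x) y)
        - ε • (P ∘L endCurv G T P x (P y))) := by
  have h1 := hG x y
  have h2 := hG (P x) y
  have h3 := hG x (P y)
  have h4 := hG (P x) (P y)
  refine Prod.ext ?_ ?_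
  · simp [paraMapNijenhuis, paraMapDeriv, paraMap_apply, hP, h1, h2, h3, h4]
  · ext u
    rcases hε with rfl | rfl <;> 
      simp [paraMapNijenhuis, paraMapDeriv, paraMap_apply, endCurv, hP, h1, h2, h3, h4] <;> abel

end Algebra

end NijenhuisAlgebra

/-! ### Skew-symmetric sections -/

section SkewSections

section

variable {D : Type*} [NormedAddCommGroup D] [NormedSpace ℝ D] {H : Type*} [TopologicalSpace H]
  {I : ModelWithCorners ℝ D H} {N : Type*} [TopologicalSpace N] [ChartedSpace H N]
  {Z W : Type*} [NormedAddCommGroup Z] [NormedSpace ℝ Z] [FiniteDimensional ℝ Z]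
  [NormedAddCommGroup W] [NormedSpace ℝ W]

theorem contMDiffAt_clm_of_apply {K : N → Z →L[ℝ] W} {x : N}
    (h : ∀ v, ContMDiffAt I 𝓘(ℝ, W) ∞ (fun y ↦ K y v) x) : ContMDiffAt I 𝓘(ℝ, Z →L[ℝ] W) ∞ K x := by
  set b := Module.finBasis ℝ Z
  have h1 : K = fun y ↦ ∑ j, ContinuousLinearMap.smulRightL ℝ Z W
      (LinearMap.toContinuousLinearMap (b.coord j)) (K y (b j)) := by
    funext y
    ext v
    conv_lhs => rw [← b.sum_repr v, map_sum]
    simp [-Module.Basis.sum_repr]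
  rw [h1]
  refine ContMDiffAt.sum fun j _ ↦ ?_
  exact contMDiffAt_const.clm_apply (h (b j))

end

variable [IsManifold 𝓘(ℝ, E) ∞ M] {n : ℕ}

theorem contMDiffAt_form_coordVec (g : NeutralMetric E M n) {p x : M}
    (hx : x ∈ (chartAt E p).source) (u v : E) :
    ContMDiffAt 𝓘(ℝ, E) 𝓘(ℝ, ℝ) ∞ (fun y ↦ g.form y (coordVec p y u) (coordVec p y v)) x := by
  have h := ContMDiffAt.clm_bundle_apply₂ (F₁ := E) (F₂ := E) (F₃ := ℝ) (E₁ := TangentSpace 𝓘(ℝ, E))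
    (E₂ := TangentSpace 𝓘(ℝ, E)) (E₃ := Trivial M ℝ) (b := fun y : M ↦ y)
    (ψ := g.form) (g.contMDiff.contMDiffAt (x := x)) (contMDiffAt_coordVec hx u) (contMDiffAt_coordVec hx v)
  rw [contMDiffAt_totalSpace] at h
  exact h.2

variable [FiniteDimensional ℝ E]

/-- A smooth local section of `g`-skew-symmetric endomorphisms through a `g`-skew-symmetric
endomorphism. -/
theorem exists_skew_section (g : NeutralMetric E M n) {p : M} {V : EndT E M p} (hV : IsSkew g V) :
    ∃ S : ∀ x : M, EndT E M x, S p = V ∧ (∀ x, IsSkew g (S x)) ∧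
      ∀ x ∈ (chartAt E p).source,
        ContMDiffAt 𝓘(ℝ, E) 𝓘(ℝ, E →L[ℝ] E) ∞ (fun y ↦ endCoord p y (S y)) x := by
  have hp := mem_chart_source E p
  obtain ⟨e, hll, hrr, hlr⟩ := g.neutral p
  set σ : Fin n ⊕ Fin n → ℝ := Sum.elim (fun _ ↦ 1) (fun _ ↦ -1) with hσ
  have hortho : ∀ j k, g.form p (e j) (e k) = if j = k then σ j else 0 := by
    rintro (j | j) (k | k)
    · simp [hll, hσ]
    · simp [hlr]
    · rw [g.symm, hlr]
      simp
    · simp [hrr, hσ]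
  have hσσ : ∀ j, σ j * σ j = 1 := by
    rintro (j | j) <;> simp [hσ]
  -- Expansion in a pseudo-orthonormal basis; `σ j` is the sign of `e j` and its own inverse.
  have hexp : ∀ u, ∑ j, (σ j * g.form p (e j) u) • e j = u := by
    intro u
    conv_rhs => rw [← e.sum_repr u]
    refine Finset.sum_congr rfl fun j _ ↦ ?_
    congr 1
    conv_lhs => rw [← e.sum_repr u, map_sum]
    simp [-Module.Basis.sum_repr, hortho]
    rw [mul_left_comm, hσσ, mul_one]
  set a : Fin n ⊕ Fin n → ∀ x : M, TangentSpace 𝓘(ℝ, E) x :=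
    fun j x ↦ coordVec p x (tangentCoord p p (e j)) with ha
  set b : Fin n ⊕ Fin n → ∀ x : M, TangentSpace 𝓘(ℝ, E) x :=
    fun j x ↦ coordVec p x (tangentCoord p p (V (e j))) with hb
  -- For skew `V`, both `Σ σ_j g(e_j, ·) V e_j` and `-Σ σ_j g(V e_j, ·) e_j` equal `V`, so half
  -- their sum is `V` at `p`. The vectors are extended with constant coordinates, and every `g(a, ·)
  -- b - g(b, ·) a` is skew at every point, whatever `a` and `b` are.
  refine ⟨fun x ↦ (1 / 2 : ℝ) • ∑ j, σ j • ((g.form x (a j x)).smulRight (b j x) -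
    (g.form x (b j x)).smulRight (a j x)), ?_, fun x X Y ↦ ?_, fun x hx ↦ ?_⟩
  · ext u
    have hap : ∀ j, a j p = e j := fun j ↦ coordVec_tangentCoord hp _
    have hbp : ∀ j, b j p = V (e j) := fun j ↦ coordVec_tangentCoord hp _
    have h1 := congrArg V (hexp u)
    have h2 := hexp (V u)
    have h3 : ∀ j, g.form p (V (e j)) u = - g.form p (e j) (V u) := fun j ↦
      eq_neg_of_add_eq_zero_left (hV _ _)
    simp only [hap, hbp, smul_apply, sum_apply, sub_apply, ContinuousLinearMap.smulRight_apply, h3,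
      smul_sub, Finset.sum_sub_distrib, smul_smul, smul_neg, neg_smul, Finset.sum_neg_distrib]
    rw [h2]
    simp only [map_sum, map_smul] at h1
    rw [h1]
    module
  · simp only [smul_apply, sum_apply, sub_apply, ContinuousLinearMap.smulRight_apply, map_smul,
      map_sum, map_sub, smul_eq_mul]
    rw [← mul_add, ← Finset.sum_add_distrib, Finset.sum_eq_zero, mul_zero]
    intro j _
    rw [g.symm x X (b j x), g.symm x X (a j x)]
    ring
  · refine contMDiffAt_clm_of_apply fun v ↦ ?_
    have h1 : (fun y ↦ endCoord p y ((1 / 2 : ℝ) • ∑ j, σ j • ((g.form y (a j y)).smulRight (b j y) -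
        (g.form y (b j y)).smulRight (a j y))) v) =ᶠ[𝓝 x] fun y ↦ (1 / 2 : ℝ) • ∑ j, σ j •
          (g.form y (a j y) (coordVec p y v) • tangentCoord p p (V (e j)) -
            g.form y (b j y) (coordVec p y v) • tangentCoord p p (e j)) := by
      filter_upwards [(chartAt E p).open_source.mem_nhds hx] with y hy
      simp [endCoord_apply, ha, hb, tangentCoord_coordVec hy]
    refine ContMDiffAt.congr_of_eventuallyEq ?_ h1
    have hc : ∀ (c : ℝ) {f : M → E}, ContMDiffAt 𝓘(ℝ, E) 𝓘(ℝ, E) ∞ f x →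
        ContMDiffAt 𝓘(ℝ, E) 𝓘(ℝ, E) ∞ (fun y ↦ c • f y) x := fun c f hf ↦
      (contMDiffAt_const (c := c) (I' := 𝓘(ℝ, ℝ))).smul hf
    have hf : ∀ u w, ContMDiffAt 𝓘(ℝ, E) 𝓘(ℝ, E) ∞
        (fun y ↦ g.form y (coordVec p y u) (coordVec p y v) • w) x := fun u w ↦
      (contMDiffAt_const (c := ContinuousLinearMap.toSpanSingleton ℝ w)).clm_apply
        (contMDiffAt_form_coordVec g hx u v)
    exact hc _ (ContMDiffAt.sum fun j _ ↦ hc _ ((hf _ _).sub (hf _ _)))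

end SkewSections

/-! ### Extensions tangent to the reflector space -/

section TangentFields

variable [IsManifold 𝓘(ℝ, E) ∞ M] {n : ℕ}

theorem vLift_zero (w : EndBundle E M) : vLift w 0 = 0 := by
  have hw := mem_chart_source E w.proj
  apply chartDeriv_injective (I := endModel E) (mem_extChartAt_source w)
  rw [chartDeriv_vLift w hw, chartDeriv_zero, map_zero, Prod.mk_zero_zero]

variable [FiniteDimensional ℝ E]
  (cov : CovariantDerivative 𝓘(ℝ, E) E (TangentSpace 𝓘(ℝ, E) : M → Type _))

theorem hLift_zero (w : EndBundle E M) : hLift cov w 0 = 0 := by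
  have hw := mem_chart_source E w.proj
  apply chartDeriv_injective (I := endModel E) (mem_extChartAt_source w)
  rw [chartDeriv_hLift cov w hw, chartDeriv_zero]
  simp

/-- Horizontal vectors extend to smooth vector fields tangent to the reflector space. -/
theorem exists_tangentField_hLift [T2Space M] (g : NeutralMetric E M n)
    (hcov : CovariantDerivative.ContMDiffCovariantDerivative cov ∞)
    (Q : EndBundle E M) (X : TangentSpace 𝓘(ℝ, E) Q.proj) :
    ∃ A, IsTangentField g cov (chartAt (ModelProd E (E →L[ℝ] E)) Q).source A ∧
      A Q = hLift cov Q X := by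
  set x := tangentCoord Q.proj Q.proj X with hx
  -- The horizontal lift of a coordinate field is tangent to `𝒵` with vertical part `0`.
  refine ⟨fun w ↦ hLift cov w (coordVec Q.proj w.proj x), ⟨fun w hw ↦ ?_, fun w _ ↦
    ⟨coordVec Q.proj w.proj x, 0, ⟨fun _ _ ↦ by simp, fun _ ↦ by simp⟩, ?_⟩⟩, ?_⟩
  · have hw' := mem_chartAt_end_source.1 hw
    refine ContMDiffAt.contMDiffWithinAt ((contMDiffAt_field_iff (I := endModel E) hw).2 ?_)
    have h1 : (fun w : EndBundle E M ↦ chartDeriv (endModel E) Q w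
        (hLift cov w (coordVec Q.proj w.proj x))) =ᶠ[𝓝 w] fun w ↦ (x,
          -(christoffel cov Q.proj w.proj x ∘L endCoord Q.proj w.proj w.snd -
            endCoord Q.proj w.proj w.snd ∘L christoffel cov Q.proj w.proj x)) := by
      filter_upwards [(chartAt (ModelProd E (E →L[ℝ] E)) Q).open_source.mem_nhds hw] with y hy
      have hy' := mem_chartAt_end_source.1 hy
      rw [chartDeriv_hLift cov Q hy', tangentCoord_coordVec hy']
    refine ContMDiffAt.congr_of_eventuallyEq ?_ h1
    have hΓ : ContMDiffAt (endModel E) 𝓘(ℝ, E →L[ℝ] E) ∞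
        (fun w : EndBundle E M ↦ christoffel cov Q.proj w.proj x) w :=
      ((contMDiffAt_christoffel cov hcov hw').comp w
        (contMDiffAt_proj (IB := 𝓘(ℝ, E)) (EndT E M))).clm_apply contMDiffAt_const
    have hP := contMDiffAt_endCoord hw'
    exact contMDiffAt_const.prodMk_space ((hΓ.clm_comp hP).sub (hP.clm_comp hΓ)).neg
  · rw [vLift_zero, add_zero]
  · simp only [hx]
    rw [coordVec_tangentCoord (mem_chart_source E Q.proj)]

/-- Vertical vectors extend to smooth vector fields tangent to the reflector space. -/
theorem exists_tangentField_vLift (g : NeutralMetric E M n) {Q : EndBundle E M}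
    (hQ : Q ∈ reflectorSpace g) {V : EndT E M Q.proj} (hV : V ∈ verticalSpace g Q) :
    ∃ A, IsTangentField g cov (chartAt (ModelProd E (E →L[ℝ] E)) Q).source A ∧
      A Q = vLift Q V := by
  obtain ⟨S, hSQ, hS, hSd⟩ := exists_skew_section g hV.1
  -- Where `P² = 1`, the map `S ↦ ½(S - PSP)` projects onto the endomorphisms anticommuting with
  -- `P`, and for skew `P` it preserves skewness. At `Q` it fixes `V`, which already anticommutes
  -- with `Q`.
  refine ⟨fun w ↦ vLift w ((1 / 2 : ℝ) • (S w.proj - w.snd ∘L S w.proj ∘L w.snd)),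
    ⟨fun w hw ↦ ?_, fun w hw ↦ ⟨0,
      (1 / 2 : ℝ) • (S w.proj - w.snd ∘L S w.proj ∘L w.snd), ⟨fun X Y ↦ ?_, fun X ↦ ?_⟩, ?_⟩⟩, ?_⟩
  · have hw' := mem_chartAt_end_source.1 hw
    refine ContMDiffAt.contMDiffWithinAt ((contMDiffAt_field_iff (I := endModel E) hw).2 ?_)
    have h1 : (fun w : EndBundle E M ↦ chartDeriv (endModel E) Q w
        (vLift w ((1 / 2 : ℝ) • (S w.proj - w.snd ∘L S w.proj ∘L w.snd)))) =ᶠ[𝓝 w] fun w ↦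
          (0, (1 / 2 : ℝ) • (endCoord Q.proj w.proj (S w.proj) - endCoord Q.proj w.proj w.snd ∘L
            endCoord Q.proj w.proj (S w.proj) ∘L endCoord Q.proj w.proj w.snd)) := by
      filter_upwards [(chartAt (ModelProd E (E →L[ℝ] E)) Q).open_source.mem_nhds hw] with y hy
      have hy' := mem_chartAt_end_source.1 hy
      rw [chartDeriv_vLift Q hy', map_smul, map_sub, endCoord_comp hy', endCoord_comp hy']
    refine ContMDiffAt.congr_of_eventuallyEq ?_ h1
    have hS' : ContMDiffAt (endModel E) 𝓘(ℝ, E →L[ℝ] E) ∞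
        (fun w : EndBundle E M ↦ endCoord Q.proj w.proj (S w.proj)) w :=
      (hSd w.proj hw').comp w (contMDiffAt_proj (IB := 𝓘(ℝ, E)) (EndT E M))
    have hP := contMDiffAt_endCoord hw'
    exact contMDiffAt_const.prodMk_space
      ((contMDiffAt_const (c := (1 / 2 : ℝ)) (I' := 𝓘(ℝ, ℝ))).smul (hS'.sub (hP.clm_comp (hS'.clm_comp hP))))
  · have hP : ∀ X Y, g.form w.proj (w.snd X) Y = - g.form w.proj X (w.snd Y) := fun X Y ↦
      eq_neg_of_add_eq_zero_left (hw.2.2 X Y)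
    have hS' : ∀ X Y, g.form w.proj (S w.proj X) Y = - g.form w.proj X (S w.proj Y) := fun X Y ↦
      eq_neg_of_add_eq_zero_left (hS w.proj X Y)
    simp [hP, hS']
    ring
  · have hP := hw.2.1.1
    simp [hP]
    module
  · rw [hLift_zero, zero_add]
  · have h : (1 / 2 : ℝ) • (S Q.proj - Q.snd ∘L S Q.proj ∘L Q.snd) = V := by
      rw [hSQ]
      ext X
      have h1 := eq_neg_of_add_eq_zero_left (hV.2 X)
      simp [h1, hQ.1.1]
      module
    simp only [h]

/-- One tangent extension of each vector settles existence, and the chart formula handles all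
extensions at once; what remains is an algebraic identity at a single point. Differentiability of
`γ` is passed on because the curvature formula requires it. -/
theorem hasNijenhuisValue_of_chartDeriv [T2Space M] (g : NeutralMetric E M n)
    (hcov : IsLeviCivita g cov) {i : ℕ} {Q : EndBundle E M} (hQ : Q ∈ reflectorSpace g)
    {ξ η ζ : TEnd Q}
    (hξ : ∃ A, IsTangentField g cov (chartAt (ModelProd E (E →L[ℝ] E)) Q).source A ∧ A Q = ξ)
    (hη : ∃ A, IsTangentField g cov (chartAt (ModelProd E (E →L[ℝ] E)) Q).source A ∧ A Q = η)
    {γ : E → E →L[ℝ] E →L[ℝ] E}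
    (hγ : γ = fun y ↦ christoffel cov Q.proj ((extChartAt 𝓘(ℝ, E) Q.proj).symm y))
    {z : E} (hz : extChartAt 𝓘(ℝ, E) Q.proj Q.proj = z)
    (h : DifferentiableAt ℝ γ z → chartDeriv (endModel E) Q Q ζ =
      paraMapNijenhuis ((-1) ^ (i + 1)) (γ z) (fderiv ℝ γ z)
        (endCoord Q.proj Q.proj Q.snd) (chartDeriv (endModel E) Q Q ξ)
        (chartDeriv (endModel E) Q Q η)) :
    HasNijenhuisValue g cov i Q ξ η ζ := by
  obtain ⟨A₀, hA₀, hA₀Q⟩ := hξ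
  obtain ⟨B₀, hB₀, hB₀Q⟩ := hη
  refine ⟨⟨_, A₀, B₀, (chartAt (ModelProd E (E →L[ℝ] E)) Q).open_source,
    mem_chart_source _ Q, hA₀, hB₀, hA₀Q, hB₀Q⟩, fun U A B hU hQU hA hB hAQ hBQ ↦ ?_⟩
  apply chartDeriv_injective (I := endModel E) (mem_extChartAt_source Q)
  obtain ⟨hd, h1⟩ := chartDeriv_nijenhuis cov hcov.smooth i hQ.1.1
    ((hA.1 Q hQU).contMDiffAt (hU.mem_nhds hQU)) ((hB.1 Q hQU).contMDiffAt (hU.mem_nhds hQU))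
    (congrArg _ hAQ) (congrArg _ hBQ) (extChartAt_end_apply Q Q) hγ rfl
  rw [h1, h (hz ▸ hd), ← hz]
  simp only [fderiv_paraMap _ hd]
  rfl

end TangentFields

end ReflectorSpace

end

/-! ### The three values of the Nijenhuis tensor -/

open ReflectorSpace in
theorem mainTheorem9
    {E : Type*} [NormedAddCommGroup E] [NormedSpace ℝ E] [FiniteDimensional ℝ E]
    {M : Type*} [TopologicalSpace M] [T2Space M] [ChartedSpace E M] [IsManifold 𝓘(ℝ, E) ∞ M]
    (n : ℕ) (g : ReflectorSpace.NeutralMetric E M n)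
    (cov : CovariantDerivative 𝓘(ℝ, E) E (TangentSpace 𝓘(ℝ, E) : M → Type _))
    (hcov : ReflectorSpace.IsLeviCivita g cov)
    (i : ℕ) (hi : i = 1 ∨ i = 2)
    (Q : ReflectorSpace.EndBundle E M) (hQ : Q ∈ ReflectorSpace.reflectorSpace g)
    (X Y : TangentSpace 𝓘(ℝ, E) Q.proj)
    (V W : ReflectorSpace.EndT E M Q.proj)
    (hV : V ∈ ReflectorSpace.verticalSpace g Q) (hW : W ∈ ReflectorSpace.verticalSpace g Q) :
    ReflectorSpace.HasNijenhuisValue g cov i Q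
      (ReflectorSpace.hLift cov Q X) (ReflectorSpace.hLift cov Q Y)
      (ReflectorSpace.vLift Q
          (ReflectorSpace.curvature (ReflectorSpace.endCov cov) X Y Q.snd)
        + ReflectorSpace.vLift Q
          (ReflectorSpace.curvature (ReflectorSpace.endCov cov) (Q.snd X) (Q.snd Y) Q.snd)
        - ReflectorSpace.paraK cov i Q (ReflectorSpace.vLift Q
          (ReflectorSpace.curvature (ReflectorSpace.endCov cov) (Q.snd X) Y Q.snd))
        - ReflectorSpace.paraK cov i Q (ReflectorSpace.vLift Q
          (ReflectorSpace.curvature (ReflectorSpace.endCov cov) X (Q.snd Y) Q.snd))) ∧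
    ReflectorSpace.HasNijenhuisValue g cov i Q
      (ReflectorSpace.hLift cov Q X) (ReflectorSpace.vLift Q V)
      (((-1 : ℝ) ^ i + 1) • ReflectorSpace.hLift cov Q (Q.snd (V X))) ∧
    ReflectorSpace.HasNijenhuisValue g cov i Q
      (ReflectorSpace.vLift Q V) (ReflectorSpace.vLift Q W) 0 := by
  have hp := mem_chart_source E Q.proj
  have hε : (-1 : ℝ) ^ (i + 1) = 1 ∨ (-1 : ℝ) ^ (i + 1) = -1 := neg_one_pow_eq_or ℝ _
  obtain ⟨γ, hγ⟩ : ∃ γ : E → E →L[ℝ] E →L[ℝ] E,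
      γ = fun y ↦ christoffel cov Q.proj ((extChartAt 𝓘(ℝ, E) Q.proj).symm y) := ⟨_, rfl⟩
  obtain ⟨z, hz⟩ : ∃ z, extChartAt 𝓘(ℝ, E) Q.proj Q.proj = z := ⟨_, rfl⟩
  have hγz : christoffel cov Q.proj Q.proj = γ z := by
    rw [hγ, ← hz]
    simp
  have hP : ∀ v, endCoord Q.proj Q.proj Q.snd (endCoord Q.proj Q.proj Q.snd v) = v := fun v ↦ by
    simp [endCoord_apply, coordVec_tangentCoord hp, hQ.1.1, tangentCoord_coordVec hp]
  have hT : ∀ L : E →L[ℝ] E →L[ℝ] E →L[ℝ] E, L 0 = 0 := fun L ↦ ContinuousLinearMap.map_zero L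
  have hX := exists_tangentField_hLift cov g hcov.smooth Q X
  have hY := exists_tangentField_hLift cov g hcov.smooth Q Y
  have hV' := exists_tangentField_vLift cov g hQ hV
  have hW' := exists_tangentField_vLift cov g hQ hW
  have hK : ∀ B, chartDeriv (endModel E) Q Q (paraK cov i Q (vLift Q B)) =
      (0, (-1 : ℝ) ^ (i + 1) • (endCoord Q.proj Q.proj Q.snd ∘L endCoord Q.proj Q.proj B)) := by
    intro B
    rw [chartDeriv_paraK cov i Q hp, chartDeriv_vLift Q hp, paraMap_apply]
    simp
  refine ⟨hasNijenhuisValue_of_chartDeriv cov g hcov hQ hX hY hγ hz fun hd ↦ ?_,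
    hasNijenhuisValue_of_chartDeriv cov g hcov hQ hX hV' hγ hz fun hd ↦ ?_,
    hasNijenhuisValue_of_chartDeriv cov g hcov hQ hV' hW' hγ hz fun hd ↦ ?_⟩
  · have hR : ∀ X Y : TangentSpace 𝓘(ℝ, E) Q.proj,
        endCoord Q.proj Q.proj (curvature (endCov cov) X Y Q.snd) =
          endCurv (γ z) (fderiv ℝ γ z) (endCoord Q.proj Q.proj Q.snd)
            (tangentCoord Q.proj Q.proj X) (tangentCoord Q.proj Q.proj Y) := fun X Y ↦
      endCoord_curvature cov hcov.smooth X Y Q.snd hγ hz hd rfl rfl rfl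
    rw [chartDeriv_sub, chartDeriv_sub, chartDeriv_add, hK, hK, chartDeriv_vLift Q hp,
      chartDeriv_vLift Q hp, chartDeriv_hLift cov Q hp, chartDeriv_hLift cov Q hp, hγz,
      paraMapNijenhuis_horizontal hε hP
        (fun u v ↦ hγz ▸ christoffel_symm cov hcov.torsion_free Q.proj u v)]
    simp only [hR, endCoord_tangentCoord hp, Prod.mk_add_mk, Prod.mk_sub_mk, add_zero, sub_zero]
  -- The algebra gives the factor `1 - (-1)^(i+1)`, rewritten here as `(-1)^i + 1`.
  · rw [chartDeriv_smul, chartDeriv_hLift cov Q hp, chartDeriv_hLift cov Q hp,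
      chartDeriv_vLift Q hp, hγz, paraMapNijenhuis_mixed hε hP (hT _), pow_succ, mul_neg_one,
      sub_neg_eq_add, add_comm (1 : ℝ)]
    simp only [endCoord_tangentCoord hp]
  · rw [chartDeriv_zero, chartDeriv_vLift Q hp, chartDeriv_vLift Q hp,
      paraMapNijenhuis_vertical hε (hT _)]
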